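/- Let $n\ge 2$, $m=n-1$, $\lambda\in\mathbb R$, $k,\alpha,\beta\in\mathbb N$ with $k=\alpha+\beta$, and $\delta=\beta-\alpha$. Let $(z,w)=(z_1,\dots,z_n,w_1,\dots,w_n)$ be the coordinates of $\mathbb C^{2n}$, and let $\mathcal H^{\alpha,\beta}$ be the space of harmonic polynomials in $z,w,\bar z,\bar w$ that are homogeneous of degree $\alpha$ in $(z,w)$ and of degree $\beta$ in $(\bar z,\bar w)$, with the left action of $\mathrm{Sp}(n)$. The complexified infinitesimal action is $dL(X)P=-\frac{\partial P}{\partial x}(Xx)+\frac{\partial P}{\partial\bar x}({}^tX\bar x)$, where $x=(z,w)$ and $X\in\mathfrak{sp}(n,\mathbb C)$. Let $\mathfrak h$ be the diagonal Cartan subalgebra, $L_r$ the $r$-th diagonal entry, with positive roots $L_r\pm L_s$ ($r<s$) and $2L_r$. For $P\in\mathcal H^{\alpha,\beta}$ let $g$ be the function on $\mathbb C^{2n}\setminus\{0\}$ that agrees with $P$ on the unit sphere and satisfies $g(cx)=(c/|c|)^{-\delta}|c|^{-i\lambda-2n}g(x)$ for $c\in\mathbb C\setminus\{0\}$. The non-compact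 form of $P$ is $G(s,u,v)=g(1,u,2s,v)$ on $\mathbb C\times\mathbb C^m\times\mathbb C^m$ (here $z=(1,u)$ and $w=(2s,v)$), and its non-standard form is $\mathcal F(G)$, with $\mathcal F=\mathcal F_\tau\circ\mathcal F_\xi$ and $$\mathcal F_\xi(g)(s,u,v)=\int_{\mathbb C^m}g(s,u,\xi)e^{-2i\pi\mathrm{Re}\langle v,\xi\rangle}d\xi,\qquad \mathcal F_\tau(g)(s,u,v)=\int_{\mathbb C}g(\tau,u,v)e^{-2i\pi\mathrm{Re}(s\tau)}d\tau,$$ where $\langle x,y\rangle=\sum_i x_iy_i$. The polynomial $P_0^{\alpha,\beta}=w_1^\alpha\bar z_1^\beta$ belongs to $\mathcal H^{\alpha,\beta}$ and is a highest weight vector of weight $(k,0,\dots,0)$, that is, of the $K$-type $\pi^{k,0}$ for $K=\mathrm{Sp}(n)$. Let $G_{\alpha,\beta}$ be its non-compact form. Then for all $(s,u,v)\in\mathbb C\times\mathbb C^m\times\mathbb C^m$ with $s\ne0$ and $v\ne0$, the integrals that define $\mathcal F(G_{\alpha,\beta})(s,u,v)$ converge absolutely (successively, in $\xi$ and then in $\tau$)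 and $$\mathcal F(G_{\alpha,\beta})(s,u,v)=\int_{\mathbb C}\int_{\mathbb C^m}\frac{(2\tau)^\alpha\,e^{-2i\pi\mathrm{Re}(s\tau+\langle v,\xi\rangle)}}{(1+4|\tau|^2+\|u\|^2+\|\xi\|^2)^{\frac{i\lambda+k}2+n}}\,d\xi\,d\tau=\psi(s,u,v),$$ $$\psi(s,u,v)=R(s,u,v)\,K_{\frac{i\lambda+\delta}2}\Big(\pi\sqrt{1+\|u\|^2}\sqrt{|s|^2+4\|v\|^2}\Big),$$ where $$R(s,u,v)=\frac{(-i\bar s)^\alpha\,\pi^{i\lambda+\beta+n}}{2^{\frac{i\lambda+k}2+1}\,\Gamma\big(\frac{i\lambda+k}2+n\big)}\left(\frac{\sqrt{|s|^2+4\|v\|^2}}{\pi\sqrt{1+\|u\|^2}}\right)^{\frac{i\lambda+\delta}2}$$ and $K_\nu(z)=\frac\pi2\,\frac{I_{-\nu}(z)-I_\nu(z)}{\sin(\nu\pi)}$ for $\nu\notin\mathbb Z$ (its limit in the order for $\nu\in\mathbb Z$), with $I_\nu(z)=\sum_{j\ge0}\frac{(z/2)^{\nu+2j}}{\Gamma(j+1)\Gamma(j+\nu+1)}$.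 If $\beta\ge1$, the iterated integral is also an absolutely convergent integral over $\mathbb C\times\mathbb C^m$. Moreover, every highest weight vector of weight $(k,0,\dots,0)$ in $\mathcal H^{\alpha,\beta}$ has a non-standard form which, at all points with $s\neq0$ and $v\neq0$, equals $c\,\psi(s,u,v)$ for some constant $c\ne0$. -/

import Mathlib

open MeasureTheory Filter Topology

noncomputable section

namespace NonStd

/-! ### Bessel functions -/

/-- Modified Bessel function of the first kind `I_ν(z)`, by its power series (principal branch of
the powers). At the poles of `Γ` Mathlib sets `Γ = 0`, so that `1 / Γ = 0` there, as it should. -/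
def besselI (ν z : ℂ) : ℂ :=
  ∑' j : ℕ, 1 / (Complex.Gamma ((j : ℂ) + 1) * Complex.Gamma ((j : ℂ) + ν + 1)) *
    (z / 2) ^ (ν + 2 * (j : ℂ))

/-- The quotient that defines `K_ν(z)` for `ν` not an integer. -/
def besselKQuot (ν z : ℂ) : ℂ :=
  (Real.pi : ℂ) / 2 * ((besselI (-ν) z - besselI ν z) / Complex.sin (ν * (Real.pi : ℂ)))

open Classical in
/-- Modified Bessel function of the third kind `K_ν(z)`: the quotient above if `ν` is not an
integer, and its limit in the order at an integer `ν`. -/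
def besselK (ν z : ℂ) : ℂ :=
  if ∃ j : ℤ, ν = (j : ℂ) then limUnder (𝓝[≠] ν) (fun ε : ℂ => besselKQuot ε z)
  else besselKQuot ν z

/-! ### Polynomials in `(z, w)` and their conjugates, and the infinitesimal action -/

/-- Index set of the coordinates of `ℂ²ⁿ`: `inl r` is `z_{r+1}` and `inr r` is `w_{r+1}`. -/
abbrev Idx (n : ℕ) : Type := Fin n ⊕ Fin n

/-- Polynomial functions on `ℂ²ⁿ ≃ ℝ⁴ⁿ`, written as polynomials in the coordinates `z, w`
(outer `inl`) and their conjugates (outer `inr`). -/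
abbrev ZPoly (n : ℕ) : Type := MvPolynomial (Idx n ⊕ Idx n) ℂ

/-- The value of such a polynomial at a point of `ℂ²ⁿ`. -/
def evalAt {n : ℕ} (P : ZPoly n) (x : Idx n → ℂ) : ℂ :=
  MvPolynomial.eval (Sum.elim x (fun i => (starRingEnd ℂ) (x i))) P

/-- The space of harmonic polynomials that are homogeneous of degree `α` in the coordinates and
of degree `β` in their conjugates (membership predicate). -/
structure IsHarm {n : ℕ} (α β : ℕ) (P : ZPoly n) : Prop where
  bihomogeneous : ∀ d ∈ P.support,
    (∑ i : Idx n, d (Sum.inl i)) = α ∧ (∑ i : Idx n, d (Sum.inr i)) = β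
  harmonic : (4 : ZPoly n) * ∑ i : Idx n,
    MvPolynomial.pderiv (Sum.inl i) (MvPolynomial.pderiv (Sum.inr i) P) = 0

/-- The infinitesimal left action, extended complex linearly from the Lie algebra of `Sp(n)` to
the one of `Sp(n, ℂ)`: with `x = (z, w)`,
`dL(X) P = - (∂P/∂x) (X x) + (∂P/∂x̄) (ᵗX x̄)`. -/
def dL {n : ℕ} (X : Matrix (Idx n) (Idx n) ℂ) (P : ZPoly n) : ZPoly n :=
  (∑ i : Idx n, MvPolynomial.pderiv (Sum.inl i) P *
      (-(∑ j : Idx n, MvPolynomial.C (X i j) * MvPolynomial.X (Sum.inl j)))) +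
    ∑ i : Idx n, MvPolynomial.pderiv (Sum.inr i) P *
      (∑ j : Idx n, MvPolynomial.C (X j i) * MvPolynomial.X (Sum.inr j))

/-- Element of the diagonal Cartan subalgebra of `sp(n, ℂ)` with diagonal `(h, -h)`. -/
def cartan {n : ℕ} (h : Fin n → ℂ) : Matrix (Idx n) (Idx n) ℂ :=
  Matrix.diagonal (Sum.elim h (fun r => -h r))

/-- Root vector of the root `L_r - L_s`. -/
def rootU {n : ℕ} (r s : Fin n) : Matrix (Idx n) (Idx n) ℂ :=
  Matrix.single (Sum.inl r) (Sum.inl s) 1 - Matrix.single (Sum.inr s) (Sum.inr r) 1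

/-- Root vector of the root `L_r + L_s`. -/
def rootV {n : ℕ} (r s : Fin n) : Matrix (Idx n) (Idx n) ℂ :=
  Matrix.single (Sum.inl r) (Sum.inr s) 1 + Matrix.single (Sum.inl s) (Sum.inr r) 1

/-- Root vector of the root `2 L_r`. -/
def rootD {n : ℕ} (r : Fin n) : Matrix (Idx n) (Idx n) ℂ :=
  Matrix.single (Sum.inl r) (Sum.inr r) 1

/-- Highest weight vectors, of highest weight `∑ r, σ r • L_r`, for the left action of `Sp(n)`
and the positive roots `L_r - L_s`, `L_r + L_s` (`r < s`), `2 L_r`. -/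
structure IsHighestWeightVector {n : ℕ} (σ : Fin n → ℤ) (P : ZPoly n) : Prop where
  ne_zero : P ≠ 0
  weight : ∀ h : Fin n → ℂ, dL (cartan h) P = MvPolynomial.C (∑ r, (σ r : ℂ) * h r) * P
  annihilated_U : ∀ r s : Fin n, r < s → dL (rootU r s) P = 0
  annihilated_V : ∀ r s : Fin n, r < s → dL (rootV r s) P = 0
  annihilated_D : ∀ r : Fin n, dL (rootD r) P = 0

/-- The polynomial `w_1 ^ α * conj(z_1) ^ β` on `ℂ²ⁿ`, `n = m + 1`. -/
def P0 (m α β : ℕ) : ZPoly (m + 1) :=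
  MvPolynomial.X (Sum.inl (Sum.inr 0)) ^ α * MvPolynomial.X (Sum.inr (Sum.inl 0)) ^ β

/-! ### Induced, non-compact and non-standard pictures -/

/-- Squared Hermitian norm. -/
def sqNorm {ι : Type} [Fintype ι] (x : ι → ℂ) : ℝ := ∑ i, ‖x i‖ ^ 2

/-- The function of the induced picture that extends the restriction of `P` to the unit sphere:
homogeneous of degree `-iλ-2n` under positive dilations (for `P` of bidegree `(α, β)` with
`δ = β - α` the condition under phases then holds by itself). -/
def inducedForm {n : ℕ} (lam : ℝ) (P : ZPoly n) (x : Idx n → ℂ) : ℂ :=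
  ((Real.sqrt (sqNorm x) : ℝ) : ℂ) ^ (-(Complex.I * (lam : ℂ)) - 2 * (n : ℂ)) *
    evalAt P (fun i => x i / ((Real.sqrt (sqNorm x) : ℝ) : ℂ))

/-- The non-compact form: restriction to the hyperplane of the points `(1, u, 2s, v)`. -/
def nonCompactForm {m : ℕ} (lam : ℝ) (P : ZPoly (m + 1)) (s : ℂ) (u v : Fin m → ℂ) : ℂ :=
  inducedForm lam P (Sum.elim (Fin.cons 1 u) (Fin.cons (2 * s) v))

/-- Partial Fourier transform in the first variable. -/
def fourierTau {m : ℕ} (g : ℂ → (Fin m → ℂ) → (Fin m → ℂ) → ℂ)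
    (s : ℂ) (u v : Fin m → ℂ) : ℂ :=
  ∫ τ : ℂ, g τ u v * Complex.exp (-2 * Complex.I * (Real.pi : ℂ) * (((s * τ).re : ℝ) : ℂ))

/-- Partial Fourier transform in the third variable. -/
def fourierXi {m : ℕ} (g : ℂ → (Fin m → ℂ) → (Fin m → ℂ) → ℂ)
    (s : ℂ) (u v : Fin m → ℂ) : ℂ :=
  ∫ ξ : Fin m → ℂ, g s u ξ *
    Complex.exp (-2 * Complex.I * (Real.pi : ℂ) * (((∑ i, v i * ξ i).re : ℝ) : ℂ))

/-- The non-standard form: image of the non-compact form under `F_τ ∘ F_ξ`. -/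
def nonStandardForm {m : ℕ} (lam : ℝ) (P : ZPoly (m + 1)) : ℂ → (Fin m → ℂ) → (Fin m → ℂ) → ℂ :=
  fourierTau (fourierXi (nonCompactForm lam P))

/-! ### The two sides of the formula -/

/-- The explicit integrand, as a function of `(τ, ξ)`; here `n = m + 1`. -/
def integrand {m : ℕ} (lam : ℝ) (k α : ℕ) (s : ℂ) (u v : Fin m → ℂ)
    (τ : ℂ) (ξ : Fin m → ℂ) : ℂ :=
  (2 * τ) ^ α /
      (((1 + 4 * ‖τ‖ ^ 2 + sqNorm u + sqNorm ξ : ℝ) : ℂ) ^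
        ((Complex.I * (lam : ℂ) + (k : ℂ)) / 2 + ((m : ℂ) + 1))) *
    Complex.exp (-2 * Complex.I * (Real.pi : ℂ) * (((s * τ + ∑ i, v i * ξ i).re : ℝ) : ℂ))

/-- The prefactor `R(s, u, v)`; here `n = m + 1`. -/
def prefactor {m : ℕ} (lam : ℝ) (k α β : ℕ) (δ : ℤ) (s : ℂ) (u v : Fin m → ℂ) : ℂ :=
  ((-Complex.I * (starRingEnd ℂ) s) ^ α *
      (Real.pi : ℂ) ^ (Complex.I * (lam : ℂ) + (β : ℂ) + ((m : ℂ) + 1))) /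
    ((2 : ℂ) ^ ((Complex.I * (lam : ℂ) + (k : ℂ)) / 2 + 1) *
      Complex.Gamma ((Complex.I * (lam : ℂ) + (k : ℂ)) / 2 + ((m : ℂ) + 1))) *
    ((Real.sqrt (‖s‖ ^ 2 + 4 * sqNorm v) / (Real.pi * Real.sqrt (1 + sqNorm u)) : ℝ) : ℂ) ^
      ((Complex.I * (lam : ℂ) + (δ : ℂ)) / 2)

/-- The function `ψ(s, u, v) = R(s, u, v) K_{(iλ+δ)/2}(π √(1+‖u‖²) √(|s|²+4‖v‖²))`. -/
def psi {m : ℕ} (lam : ℝ) (k α β : ℕ) (δ : ℤ) (s : ℂ) (u v : Fin m → ℂ) : ℂ :=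
  prefactor lam k α β δ s u v *
    besselK ((Complex.I * (lam : ℂ) + (δ : ℂ)) / 2)
      ((Real.pi * Real.sqrt (1 + sqNorm u) * Real.sqrt (‖s‖ ^ 2 + 4 * sqNorm v) : ℝ) : ℂ)

end NonStd

end

open NonStd

noncomputable section

namespace NonStd

/-! ### Bessel–Clifford functions and the integral representation of `K_ν` -/

section

/-! On the slice `(1, u, 2τ, ξ)` the normalised polynomial becomes `(2τ)^α N^(-μ)`, with `N = 1 +
4|τ|² + ‖u‖² + ‖ξ‖²` and `μ = (iλ + k)/2 + n`. The Gamma integral writes `N^(-μ)` as a superposition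
over `t > 0` of Gaussians `exp(-tN)`, whose Fourier transforms are explicit. Fubini is applied once
for `ξ` (`integral_phase_div_cpow`) and once for `τ` (`integral_integral_pow_mul_cpow_mul_exp`),
since joint absolute convergence requires `β ≥ 1`. The first step produces `exp(-π²‖v‖²/t)`, and for
`v ≠ 0` this factor makes the `τ`-integral converge absolutely. What remains is `∫ t^(ν-1) exp(-At -
Q/t) dt` with `ν = (iλ + δ)/2`, which rescales to `macdonaldIntegral`.

That this integral gives `K_ν`, defined through `I_ν` and `I_{-ν}`, is `besselK_eq`. The difference
of the two sides, `macdonaldDefect`, satisfies `D_ν' = D_{ν-1}` and `D_{-ν} = -q^(-ν) D_ν`. For `0 <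
Re ν < 1` the pair `(D_ν, D_{1-ν})` therefore solves a linear first-order system with coefficients
integrable at `0`, and it tends to `0` there by the reflection formula of `Γ`; a Gronwall argument
makes it vanish. Differentiation, reflection and continuity in `ν` then cover all orders, integers
included.

The last claim rests on `eq_C_mul_P0`: bidegree and the `L_1`-weight leave a single monomial. -/

/-- The Bessel–Clifford function `∑ q ^ j / (j! Γ(j + μ + 1))`. -/
def besselClifford (μ q : ℂ) : ℂ :=
  ∑' j : ℕ, (Complex.Gamma ((j : ℂ) + μ + 1))⁻¹ * (q ^ j / (j.factorial : ℂ))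

/-- On a compact set of orders the coefficients `1 / Γ(j + μ + 1)` are uniformly bounded. -/
theorem exists_bound_inv_Gamma {K : Set ℂ} (hK : IsCompact K) :
    ∃ C : ℝ, 0 ≤ C ∧ ∀ μ ∈ K, ∀ j : ℕ, ‖(Complex.Gamma ((j : ℂ) + μ + 1))⁻¹‖ ≤ C := by
  obtain ⟨N, hN⟩ : ∃ N : ℕ, ∀ μ ∈ K, ‖μ‖ ≤ N := by
    obtain ⟨r, hr⟩ := hK.isBounded.exists_norm_le
    obtain ⟨N, hN⟩ := exists_nat_ge r
    exact ⟨N, fun μ hμ => (hr μ hμ).trans hN⟩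
  have hb : ∀ j : ℕ, ∃ C : ℝ, ∀ μ ∈ K, ‖(Complex.Gamma ((j : ℂ) + μ + 1))⁻¹‖ ≤ C := by
    intro j
    have hc : Continuous fun μ : ℂ => (Complex.Gamma ((j : ℂ) + μ + 1))⁻¹ :=
      Complex.differentiable_one_div_Gamma.continuous.comp (by fun_prop)
    exact hK.exists_bound_of_continuousOn hc.continuousOn
  choose c hc using hb
  refine ⟨∑ j ∈ Finset.range (N + 1), |c j|, Finset.sum_nonneg fun _ _ => abs_nonneg _, ?_⟩
  intro μ hμ j
  have hle : ∀ i ≤ N, ‖(Complex.Gamma ((i : ℂ) + μ + 1))⁻¹‖ ≤ ∑ j ∈ Finset.range (N + 1), |c j| :=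
    fun i hi => ((hc i μ hμ).trans (le_abs_self _)).trans
      (Finset.single_le_sum (f := fun j => |c j|) (fun _ _ => abs_nonneg _)
        (Finset.mem_range.2 (Nat.lt_succ_of_le hi)))
  rcases le_total j N with h | h
  · exact hle j h
  · induction j, h using Nat.le_induction with
    | base => exact hle N le_rfl
    | succ i hi ih =>
      refine le_trans ?_ ih
      -- From `1/Γ(z) = z/Γ(z+1)` with `|z| ≥ i + 1 - |μ| ≥ 1`, the coefficients do not increase in
      -- norm beyond `N`.
      have h1 := Complex.one_div_Gamma_eq_self_mul_one_div_Gamma_add_one ((i : ℂ) + μ + 1)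
      have h2 : (1 : ℝ) ≤ ‖(i : ℂ) + μ + 1‖ := by
        have h3 : ‖((i : ℂ) + 1)‖ ≤ ‖(i : ℂ) + μ + 1‖ + ‖μ‖ := by
          rw [show ((i : ℂ) + 1) = ((i : ℂ) + μ + 1) - μ by ring]
          exact norm_sub_le _ _
        have h4 : ‖((i : ℂ) + 1)‖ = (i : ℝ) + 1 := by
          have : ((i : ℂ) + 1) = ((i + 1 : ℕ) : ℂ) := by push_cast; ring
          rw [this, Complex.norm_natCast]; push_cast; ring
        have h5 := hN μ hμ
        have h6 : (N : ℝ) ≤ i := by exact_mod_cast hi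
        linarith
      have h3 : (((i + 1 : ℕ) : ℂ) + μ + 1) = ((i : ℂ) + μ + 1) + 1 := by push_cast; ring
      rw [h3, h1, norm_mul]
      exact le_mul_of_one_le_left (norm_nonneg _) h2

theorem summable_besselClifford (μ q : ℂ) :
    Summable fun j : ℕ => (Complex.Gamma ((j : ℂ) + μ + 1))⁻¹ * (q ^ j / (j.factorial : ℂ)) := by
  obtain ⟨C, -, hC⟩ := exists_bound_inv_Gamma (isCompact_singleton (x := μ))
  refine Summable.of_norm_bounded
    (g := fun j : ℕ => C * (‖q‖ ^ j / (j.factorial : ℝ)))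
    ((Real.summable_pow_div_factorial ‖q‖).mul_left C) fun j => ?_
  rw [norm_mul, norm_div, norm_pow, Complex.norm_natCast]
  gcongr
  exact hC μ rfl j

theorem continuous_besselClifford_order (q : ℂ) : Continuous fun μ => besselClifford μ q := by
  refine continuous_iff_continuousAt.2 fun μ => ?_
  obtain ⟨C, -, hC⟩ := exists_bound_inv_Gamma (isCompact_closedBall μ 1)
  have : ContinuousOn (fun μ => besselClifford μ q) (Metric.closedBall μ 1) := by
    refine continuousOn_tsum (u := fun j : ℕ => C * (‖q‖ ^ j / (j.factorial : ℝ))) (fun j => ?_)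
      ((Real.summable_pow_div_factorial ‖q‖).mul_left C) fun j x hx => ?_
    · have hc : Continuous fun μ : ℂ => (Complex.Gamma ((j : ℂ) + μ + 1))⁻¹ :=
        Complex.differentiable_one_div_Gamma.continuous.comp (by fun_prop)
      exact (hc.mul continuous_const).continuousOn
    · rw [norm_mul, norm_div, norm_pow, Complex.norm_natCast]
      gcongr
      exact hC x hx j
  exact this.continuousAt (Metric.closedBall_mem_nhds μ one_pos)

/-- Termwise differentiation, majorised on a ball that contains both `0` and `q`; the factor `j /
j!` shifts the index and so raises the order. -/
theorem hasDerivAt_besselClifford (μ q : ℂ) :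
    HasDerivAt (besselClifford μ) (besselClifford (μ + 1) q) q := by
  obtain ⟨C, hC0, hC⟩ := exists_bound_inv_Gamma (isCompact_singleton (x := μ))
  set g' : ℕ → ℂ → ℂ := fun j y =>
    (Complex.Gamma ((j : ℂ) + μ + 1))⁻¹ * ((j : ℂ) * y ^ (j - 1) / (j.factorial : ℂ)) with hg'
  set R : ℝ := ‖q‖ + 1
  have hsucc : ∀ (j : ℕ) (y : ℂ), g' (j + 1) y =
      (Complex.Gamma ((j : ℂ) + (μ + 1) + 1))⁻¹ * (y ^ j / (j.factorial : ℂ)) := by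
    intro j y
    have h1 : ((j : ℂ) + 1) ≠ 0 := Nat.cast_add_one_ne_zero j
    have h2 : (j.factorial : ℂ) ≠ 0 := by exact_mod_cast j.factorial_ne_zero
    simp only [hg', Nat.factorial_succ, Nat.add_sub_cancel]
    push_cast
    rw [show (j : ℂ) + 1 + μ + 1 = (j : ℂ) + (μ + 1) + 1 by ring]
    congr 1
    field_simp
  set u : ℕ → ℝ := fun j => C * ((j : ℝ) * R ^ (j - 1) / (j.factorial : ℝ))
  have hu : Summable u := by
    rw [← summable_nat_add_iff 1]
    refine ((Real.summable_pow_div_factorial R).mul_left C).congr fun j => ?_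
    have h1 : ((j : ℝ) + 1) ≠ 0 := Nat.cast_add_one_ne_zero j
    have h2 : (j.factorial : ℝ) ≠ 0 := by exact_mod_cast j.factorial_ne_zero
    simp only [u, Nat.factorial_succ, Nat.add_sub_cancel]
    push_cast
    congr 1
    field_simp
  have hd := hasDerivAt_tsum_of_isPreconnected (𝕜 := ℂ) (u := u) (t := Metric.ball 0 R)
    (g := fun j y => (Complex.Gamma ((j : ℂ) + μ + 1))⁻¹ * (y ^ j / (j.factorial : ℂ)))
    (g' := g') (y₀ := q) (y := q) hu Metric.isOpen_ball (convex_ball 0 R).isPreconnected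
    (fun j y _ => ((hasDerivAt_pow j y).div_const _).const_mul _)
    (fun j y hy => by
      have hy' : ‖y‖ ≤ R := by simpa using (Metric.mem_ball.1 hy).le
      simp only [hg', u, norm_mul, norm_div, norm_pow, Complex.norm_natCast]
      gcongr
      exact hC μ rfl j)
    (by simp [R]) (summable_besselClifford μ q) (by simp [R])
  have hs : Summable fun j => g' j q := by
    rw [← summable_nat_add_iff 1]
    simp only [hsucc]
    exact summable_besselClifford (μ + 1) q
  have hg'0 : g' 0 q = 0 := by simp [hg']
  rw [hs.tsum_eq_zero_add, hg'0, zero_add] at hd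
  simp only [hsucc] at hd
  exact hd

/-- The three-term recurrence of the Bessel–Clifford functions. -/
theorem besselClifford_recurrence (μ q : ℂ) :
    besselClifford μ q = (μ + 1) * besselClifford (μ + 1) q + q * besselClifford (μ + 2) q := by
  have h0 := summable_besselClifford μ q
  have h1 := summable_besselClifford (μ + 1) q
  have h2 := summable_besselClifford (μ + 2) q
  have h3 : ∀ j : ℕ, (Complex.Gamma ((j : ℂ) + μ + 1))⁻¹ * (q ^ j / (j.factorial : ℂ)) =
      (μ + 1) * ((Complex.Gamma ((j : ℂ) + (μ + 1) + 1))⁻¹ * (q ^ j / (j.factorial : ℂ))) +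
      (j : ℂ) * ((Complex.Gamma ((j : ℂ) + (μ + 1) + 1))⁻¹ * (q ^ j / (j.factorial : ℂ))) := by
    intro j
    rw [Complex.one_div_Gamma_eq_self_mul_one_div_Gamma_add_one,
      show (j : ℂ) + μ + 1 + 1 = (j : ℂ) + (μ + 1) + 1 by ring]
    ring
  have h4 : HasSum (fun j : ℕ => (j : ℂ) *
      ((Complex.Gamma ((j : ℂ) + (μ + 1) + 1))⁻¹ * (q ^ j / (j.factorial : ℂ))))
      (q * besselClifford (μ + 2) q) := by
    rw [← hasSum_nat_add_iff' 1]
    simp only [Finset.range_one, Finset.sum_singleton, Nat.cast_zero, zero_mul, sub_zero]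
    refine (h2.hasSum.mul_left q).congr_fun fun j => ?_
    have h1 : ((j : ℂ) + 1) ≠ 0 := Nat.cast_add_one_ne_zero j
    have h2 : (j.factorial : ℂ) ≠ 0 := by exact_mod_cast j.factorial_ne_zero
    rw [Nat.factorial_succ]
    push_cast
    rw [show (j : ℂ) + 1 + (μ + 1) + 1 = (j : ℂ) + (μ + 2) + 1 by ring]
    field_simp
    ring
  have h5 := (h1.hasSum.mul_left (μ + 1)).add h4
  rw [← funext h3] at h5
  exact h5.tsum_eq

theorem besselClifford_zero (μ : ℂ) : besselClifford μ 0 = (Complex.Gamma (μ + 1))⁻¹ := by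
  rw [besselClifford, tsum_eq_single 0]
  · simp
  · intro j hj; simp [hj]

/-- Separates the branch-dependent power from a factor that is differentiable in its argument and
continuous in the order. -/
theorem besselI_eq (ν : ℂ) {x : ℝ} (hx : 0 < x) :
    besselI ν x = ((x / 2 : ℝ) : ℂ) ^ ν * besselClifford ν ((x / 2 : ℝ) ^ 2 : ℝ) := by
  have h : ((x / 2 : ℝ) : ℂ) ≠ 0 := by exact_mod_cast (half_pos hx).ne'
  rw [besselI, besselClifford, ← tsum_mul_left]
  refine tsum_congr fun j => ?_
  rw [Complex.Gamma_nat_eq_factorial, show ((x : ℂ) / 2) = ((x / 2 : ℝ) : ℂ) by push_cast; ring,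
    Complex.cpow_add _ _ h, show (2 * (j : ℂ)) = ((2 * j : ℕ) : ℂ) by push_cast; ring,
    Complex.cpow_natCast, Complex.ofReal_pow, ← pow_mul, one_div, mul_inv]
  ring

end

/-! ### The integral `∫₀^∞ t^(ν-1) exp(-t - q/t) dt` as a function of `q` and `ν`. -/

section
open Set

/-- `q ^ ν` times the Bessel–Clifford function of order `ν`. -/
theorem hasDerivAt_cpow_mul_besselClifford (ν : ℂ) {q : ℝ} (hq : 0 < q) :
    HasDerivAt (fun x : ℝ => (x : ℂ) ^ ν * besselClifford ν x)
      ((q : ℂ) ^ (ν - 1) * besselClifford (ν - 1) q) q := by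
  have hq' : (q : ℂ) ≠ 0 := by exact_mod_cast hq.ne'
  have h1 : HasDerivAt (fun x : ℂ => x ^ ν) (ν * (q : ℂ) ^ (ν - 1)) q :=
    Complex.hasStrictDerivAt_cpow_const (Or.inl (by simpa using hq)) |>.hasDerivAt
  have h2 := (h1.mul (hasDerivAt_besselClifford ν q)).comp_ofReal
  refine h2.congr_deriv ?_
  rw [besselClifford_recurrence (ν - 1), show ν - 1 + 1 = ν by ring, show ν - 1 + 2 = ν + 1 by ring,
    Complex.cpow_sub _ _ hq', Complex.cpow_one]
  field_simp

/-- The integral `∫₀^∞ t ^ (ν - 1) exp (- t - q / t) dt`. -/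
def macdonaldIntegral (ν : ℂ) (q : ℝ) : ℂ :=
  ∫ t in Ioi (0 : ℝ), (t : ℂ) ^ (ν - 1) * (Real.exp (-t - q / t) : ℂ)

theorem measurable_macdonald_integrand (ν : ℂ) (p q : ℝ) :
    Measurable fun t : ℝ => (t : ℂ) ^ ν * (Real.exp (-(p * t) - q / t) : ℂ) := by
  fun_prop

/-- `t ^ a exp (- p t - q / t)` is integrable on `(0, ∞)` for `p, q > 0` and all `a`. -/
theorem integrableOn_rpow_mul_exp (a : ℝ) {p q : ℝ} (hp : 0 < p) (hq : 0 < q) :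
    IntegrableOn (fun t : ℝ => t ^ a * Real.exp (-(p * t) - q / t)) (Ioi 0) := by
  -- The bound `exp(-q/t) ≤ N! (t/q)^N` turns `t^a` into `t^(a+N)` with `a + N > 0`, which is
  -- harmless at `0`.
  obtain ⟨N, hN⟩ := exists_nat_gt (-a)
  have hi : IntegrableOn (fun t : ℝ => (N.factorial / q ^ N) * (t ^ (a + N) * Real.exp (-p * t)))
      (Ioi 0) := by
    refine Integrable.const_mul ?_ _
    have := integrableOn_rpow_mul_exp_neg_mul_rpow (s := a + N) (p := 1) (b := p) (by linarith)
      one_pos hp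
    simpa [IntegrableOn] using this
  refine Integrable.mono' hi ?_ ?_
  · exact Measurable.aestronglyMeasurable (by fun_prop)
  · refine (ae_restrict_iff' measurableSet_Ioi).2 (Eventually.of_forall fun t ht => ?_)
    have ht : 0 < t := ht
    have h1 : (q / t) ^ N / N.factorial ≤ Real.exp (q / t) :=
      Real.pow_div_factorial_le_exp _ (by positivity) N
    have h2 : Real.exp (-(q / t)) ≤ N.factorial / q ^ N * t ^ N := by
      rw [Real.exp_neg]
      have h3 : 0 < (q / t) ^ N / N.factorial := by positivity
      refine (inv_anti₀ h3 h1).trans (le_of_eq ?_)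
      rw [div_pow]
      field_simp
    rw [Real.norm_of_nonneg (by positivity), sub_eq_add_neg, Real.exp_add, Real.rpow_add ht,
      Real.rpow_natCast]
    calc t ^ a * (Real.exp (-(p * t)) * Real.exp (-(q / t)))
        ≤ t ^ a * (Real.exp (-(p * t)) * (N.factorial / q ^ N * t ^ N)) := by gcongr
      _ = _ := by rw [neg_mul]; ring

theorem norm_cpow_mul_exp (ν : ℂ) {t : ℝ} (ht : 0 < t) (y : ℝ) :
    ‖(t : ℂ) ^ ν * (Real.exp y : ℂ)‖ = t ^ ν.re * Real.exp y := by
  rw [norm_mul, Complex.norm_cpow_eq_rpow_re_of_pos ht, Complex.norm_real,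
    Real.norm_of_nonneg (Real.exp_pos _).le]

theorem integrableOn_cpow_mul_exp (ν : ℂ) {p q : ℝ} (hp : 0 < p) (hq : 0 < q) :
    IntegrableOn (fun t : ℝ => (t : ℂ) ^ ν * (Real.exp (-(p * t) - q / t) : ℂ)) (Ioi 0) := by
  refine Integrable.mono' (integrableOn_rpow_mul_exp ν.re hp hq)
    (measurable_macdonald_integrand ν p q).aestronglyMeasurable
    ((ae_restrict_iff' measurableSet_Ioi).2 (Eventually.of_forall fun t ht => ?_))
  exact (norm_cpow_mul_exp ν ht _).le

/-- Differentiating `exp(-q/t)` produces `-1/t`, which lowers the order by one. For parameters above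
`q/2` the integrand with `q/2` dominates. -/
theorem hasDerivAt_macdonaldIntegral (ν : ℂ) {q : ℝ} (hq : 0 < q) :
    HasDerivAt (macdonaldIntegral ν) (-macdonaldIntegral (ν - 1) q) q := by
  have h := hasDerivAt_integral_of_dominated_loc_of_deriv_le (μ := volume.restrict (Ioi (0 : ℝ)))
    (F := fun (x : ℝ) (t : ℝ) => (t : ℂ) ^ (ν - 1) * (Real.exp (-t - x / t) : ℂ))
    (F' := fun (x : ℝ) (t : ℝ) => -((t : ℂ) ^ (ν - 1 - 1) * (Real.exp (-t - x / t) : ℂ)))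
    (x₀ := q) (s := Ioi (q / 2)) (bound := fun t => t ^ (ν.re - 2) * Real.exp (-(1 * t) - (q / 2) / t))
    (Ioi_mem_nhds (by linarith))
    (Eventually.of_forall fun x => by
      simpa using (measurable_macdonald_integrand (ν - 1) 1 x).aestronglyMeasurable)
    (by simpa [IntegrableOn] using integrableOn_cpow_mul_exp (ν - 1) one_pos hq)
    (AEStronglyMeasurable.neg (by
      simpa using (measurable_macdonald_integrand (ν - 1 - 1) 1 q).aestronglyMeasurable))
    ((ae_restrict_iff' measurableSet_Ioi).2 (Eventually.of_forall fun t ht x hx => by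
      have ht : 0 < t := ht
      have hx : q / 2 < x := hx
      rw [norm_neg, norm_cpow_mul_exp _ ht, one_mul]
      have : (ν - 1 - 1).re = ν.re - 2 := by simp; ring
      rw [this]
      gcongr))
    (integrableOn_rpow_mul_exp _ one_pos (by linarith))
    ((ae_restrict_iff' measurableSet_Ioi).2 (Eventually.of_forall fun t ht x hx => by
      have ht : 0 < t := ht
      have ht' : (t : ℂ) ≠ 0 := by exact_mod_cast ht.ne'
      have h1 : HasDerivAt (fun x : ℝ => Real.exp (-t - x / t))
          (Real.exp (-t - x / t) * (-(1 / t))) x :=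
        (((hasDerivAt_id x).div_const t).const_sub (-t)).exp
      have h2 := (h1.ofReal_comp).const_mul ((t : ℂ) ^ (ν - 1))
      refine h2.congr_deriv ?_
      rw [Complex.cpow_sub (ν - 1) 1 ht', Complex.cpow_one]
      push_cast
      ring))
  refine h.2.congr_deriv ?_
  rw [integral_neg, macdonaldIntegral]

/-- The substitution `t ↦ q/t` exchanges the two exponents `t` and `q/t`; it is carried out as a
scaling by `q` followed by an inversion. -/
theorem macdonaldIntegral_neg (ν : ℂ) {q : ℝ} (hq : 0 < q) :
    macdonaldIntegral (-ν) q = (q : ℂ) ^ (-ν) * macdonaldIntegral ν q := by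
  have hq' : (q : ℂ) ≠ 0 := by exact_mod_cast hq.ne'
  set g : ℝ → ℂ := fun t => (t : ℂ) ^ (-ν - 1) * (Real.exp (-t - q / t) : ℂ)
  have h1 : ∫ t in Ioi (0 : ℝ), g t = q • ∫ t in Ioi (0 : ℝ), g (q * t) := by
    have := integral_comp_mul_left_Ioi g 0 hq
    rw [mul_zero] at this
    rw [this, smul_smul, mul_inv_cancel₀ hq.ne', one_smul]
  have h2 := integral_comp_rpow_Ioi (fun t => g (q * t)) (p := -1) (by norm_num)
  rw [macdonaldIntegral, h1, ← h2, macdonaldIntegral, ← integral_const_mul, ← integral_smul]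
  refine setIntegral_congr_fun measurableSet_Ioi fun t ht => ?_
  have ht : 0 < t := ht
  have ht' : (t : ℂ) ≠ 0 := by exact_mod_cast ht.ne'
  simp only [g, Complex.real_smul]
  rw [Real.rpow_neg_one, show -(q * t⁻¹) - q / (q * t⁻¹) = -t - q / t by field_simp; ring,
    abs_neg, abs_one, one_mul, Complex.ofReal_mul, Complex.mul_cpow_ofReal_nonneg hq.le (by positivity),
    Complex.ofReal_inv, Complex.inv_cpow _ _ (by rw [Complex.arg_ofReal_of_nonneg ht.le]; exact Real.pi_pos.ne),
    show (-1 - 1 : ℝ) = ((-2 : ℤ) : ℝ) by norm_num, Real.rpow_intCast, ← Complex.cpow_neg,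
    show -(-ν - 1) = (ν - 1) + (2 : ℕ) by push_cast; ring, Complex.cpow_add _ _ ht',
    Complex.cpow_natCast, Complex.cpow_sub _ _ hq', Complex.cpow_one]
  push_cast
  rw [zpow_neg]
  field_simp

theorem tendsto_macdonaldIntegral_zero {ν : ℂ} (hν : 0 < ν.re) :
    Tendsto (macdonaldIntegral ν) (𝓝[>] 0) (𝓝 (Complex.Gamma ν)) := by
  rw [Complex.Gamma_eq_integral hν, Complex.GammaIntegral]
  refine tendsto_integral_filter_of_dominated_convergence
    (fun t => Real.exp (-t) * t ^ (ν.re - 1)) (Eventually.of_forall fun q => ?_) ?_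
    (Real.GammaIntegral_convergent hν) ?_
  · simpa using (measurable_macdonald_integrand (ν - 1) 1 q).aestronglyMeasurable
  · filter_upwards [self_mem_nhdsWithin] with q hq
    refine (ae_restrict_iff' measurableSet_Ioi).2 (Eventually.of_forall fun t ht => ?_)
    have ht : 0 < t := ht
    have hq : 0 < q := hq
    rw [norm_cpow_mul_exp _ ht, mul_comm, Complex.sub_re, Complex.one_re]
    gcongr
    have : 0 ≤ q / t := by positivity
    linarith
  · refine Eventually.of_forall fun t => ?_
    have : Continuous fun q : ℝ => (t : ℂ) ^ (ν - 1) * (Real.exp (-t - q / t) : ℂ) := by fun_prop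
    have h := this.tendsto 0
    rw [zero_div, sub_zero, mul_comm] at h
    exact h.mono_left nhdsWithin_le_nhds

/-- For `|μ - ν| ≤ 1` the power `t^(Re μ - 1)` is at most the sum of the powers at the two extreme
exponents, one serving `t ≤ 1` and the other `t ≥ 1`. -/
theorem continuous_macdonaldIntegral_order {q : ℝ} (hq : 0 < q) :
    Continuous fun ν => macdonaldIntegral ν q := by
  refine continuous_iff_continuousAt.2 fun ν => ?_
  refine continuousAt_of_dominated (bound := fun t =>
    t ^ (ν.re - 1 - 1) * Real.exp (-(1 * t) - q / t) + t ^ (ν.re + 1 - 1) * Real.exp (-(1 * t) - q / t))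
    (Eventually.of_forall fun μ => ?_) ?_
    ((integrableOn_rpow_mul_exp _ one_pos hq).add (integrableOn_rpow_mul_exp _ one_pos hq)) ?_
  · simpa using (measurable_macdonald_integrand (μ - 1) 1 q).aestronglyMeasurable
  · filter_upwards [Metric.closedBall_mem_nhds ν one_pos] with μ hμ
    refine (ae_restrict_iff' measurableSet_Ioi).2 (Eventually.of_forall fun t ht => ?_)
    have ht : 0 < t := ht
    rw [norm_cpow_mul_exp _ ht, one_mul, ← add_mul, Complex.sub_re, Complex.one_re]
    gcongr
    have h1 : |μ.re - ν.re| ≤ 1 := by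
      rw [← Complex.sub_re]
      exact (Complex.abs_re_le_norm _).trans (by simpa [dist_eq_norm] using hμ)
    rw [abs_le] at h1
    rcases le_total t 1 with h | h
    · have := Real.rpow_le_rpow_of_exponent_ge ht h (show ν.re - 1 - 1 ≤ μ.re - 1 by linarith)
      have h2 : 0 ≤ t ^ (ν.re + 1 - 1) := by positivity
      linarith
    · have := Real.rpow_le_rpow_of_exponent_le h (show μ.re - 1 ≤ ν.re + 1 - 1 by linarith)
      have h2 : 0 ≤ t ^ (ν.re - 1 - 1) := by positivity
      linarith
  · refine (ae_restrict_iff' measurableSet_Ioi).2 (Eventually.of_forall fun t ht => ?_)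
    have ht' : (t : ℂ) ≠ 0 := by exact_mod_cast (show 0 < t from ht).ne'
    have : Continuous fun μ : ℂ => (t : ℂ) ^ (μ - 1) :=
      Continuous.const_cpow (by fun_prop) (Or.inl ht')
    exact (this.mul continuous_const).continuousAt

end

/-! ### Vanishing of the defect and the integral formula for `K_ν`. -/

section
open Set

/-- The difference of `sin(πν) ∫₀^∞ t ^ (ν - 1) exp (- t - q / t) dt` and of
`π (E_{-ν}(q) - q ^ ν E_ν(q))`, with `E` the Bessel–Clifford function. -/
def macdonaldDefect (ν : ℂ) (q : ℝ) : ℂ :=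
  Complex.sin (Real.pi * ν) * macdonaldIntegral ν q -
    Real.pi * (besselClifford (-ν) q - (q : ℂ) ^ ν * besselClifford ν q)

/-- The minus sign from differentiating the integral is absorbed by `sin(πν - π) = -sin(πν)`, so all
three terms shift to order `ν - 1` together. -/
theorem hasDerivAt_macdonaldDefect (ν : ℂ) {q : ℝ} (hq : 0 < q) :
    HasDerivAt (macdonaldDefect ν) (macdonaldDefect (ν - 1) q) q := by
  have h := ((hasDerivAt_macdonaldIntegral ν hq).const_mul (Complex.sin (Real.pi * ν))).sub
    (((hasDerivAt_besselClifford (-ν) q).comp_ofReal.sub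
      (hasDerivAt_cpow_mul_besselClifford ν hq)).const_mul (Real.pi : ℂ))
  refine h.congr_deriv ?_
  rw [macdonaldDefect, show (Real.pi : ℂ) * (ν - 1) = Real.pi * ν - Real.pi by ring,
    Complex.sin_sub_pi, show -(ν - 1) = -ν + 1 by ring]
  ring

theorem macdonaldDefect_neg (ν : ℂ) {q : ℝ} (hq : 0 < q) :
    macdonaldDefect (-ν) q = -(q : ℂ) ^ (-ν) * macdonaldDefect ν q := by
  have hq' : (q : ℂ) ≠ 0 := by exact_mod_cast hq.ne'
  have h : (q : ℂ) ^ (-ν) * (q : ℂ) ^ ν = 1 := by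
    rw [← Complex.cpow_add _ _ hq', neg_add_cancel, Complex.cpow_zero]
  rw [macdonaldDefect, macdonaldDefect, macdonaldIntegral_neg ν hq, mul_neg, Complex.sin_neg,
    neg_neg]
  linear_combination (Real.pi : ℂ) * besselClifford ν q * h

/-- In this strip `q^ν → 0`, and the remaining limit `sin(πν) Γ(ν) - π/Γ(1-ν)` is zero by the
reflection formula. -/
theorem tendsto_macdonaldDefect_zero {ν : ℂ} (h0 : 0 < ν.re) (h1 : ν.re < 1) :
    Tendsto (macdonaldDefect ν) (𝓝[>] 0) (𝓝 0) := by
  have hE : ∀ μ : ℂ, Tendsto (fun q : ℝ => besselClifford μ q) (𝓝[>] 0)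
      (𝓝 (Complex.Gamma (μ + 1))⁻¹) := by
    intro μ
    have := ((hasDerivAt_besselClifford μ ((0 : ℝ) : ℂ)).comp_ofReal).continuousAt.tendsto
    simp only [Complex.ofReal_zero, besselClifford_zero] at this
    exact this.mono_left nhdsWithin_le_nhds
  have hpow : Tendsto (fun q : ℝ => (q : ℂ) ^ ν) (𝓝[>] 0) (𝓝 0) := by
    have := (Complex.continuousAt_ofReal_cpow_const 0 ν (Or.inl h0)).tendsto
    rw [Complex.ofReal_zero, Complex.zero_cpow (by rintro rfl; simp at h0)] at this
    exact this.mono_left nhdsWithin_le_nhds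
  have h := ((tendsto_macdonaldIntegral_zero h0).const_mul (Complex.sin (Real.pi * ν))).sub
    (((hE (-ν)).sub (hpow.mul (hE ν))).const_mul (Real.pi : ℂ))
  refine (show _ = (0 : ℂ) from ?_) ▸ h
  have hr := Complex.Gamma_mul_Gamma_one_sub ν
  have hG : Complex.Gamma (1 - ν) ≠ 0 :=
    Complex.Gamma_ne_zero_of_re_pos (by simpa using h1)
  have hs : Complex.sin (Real.pi * ν) ≠ 0 := by
    intro hs
    rw [hs, div_zero] at hr
    exact mul_ne_zero (Complex.Gamma_ne_zero_of_re_pos h0) hG hr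
  rw [eq_div_iff hs] at hr
  rw [zero_mul, sub_zero, show -ν + 1 = 1 - ν by ring]
  rw [sub_eq_zero, ← div_eq_mul_inv, eq_div_iff hG]
  linear_combination hr

/-- Derivative and reflection rules close up to `f' = -q^(ν-1) g` and `g' = -q^(-ν) f`. The
coefficients have norms `q^(a-1)` and `q^(-a)`, integrable at `0` as `0 < a < 1`, so Gronwall's
argument can start from the zero limit there. -/
theorem macdonaldDefect_eq_zero_of_re_mem_Ioo {ν : ℂ} (h0 : 0 < ν.re) (h1 : ν.re < 1)
    {q : ℝ} (hq : 0 < q) : macdonaldDefect ν q = 0 := by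
  set a := ν.re with ha
  set f := macdonaldDefect ν with hf
  set g := macdonaldDefect (1 - ν) with hg
  -- A primitive of the sum of the two coefficient norms, finite at `0`; the weight `exp(-W)` makes
  -- the energy `‖f‖² + ‖g‖²` nonincreasing.
  set W : ℝ → ℝ := fun q => q ^ a / a + q ^ (1 - a) / (1 - a) with hW
  set φ : ℝ → ℝ := fun q => (‖f q‖ ^ 2 + ‖g q‖ ^ 2) * Real.exp (-W q) with hφ
  have hfd : ∀ x : ℝ, 0 < x → HasDerivAt f (-(x : ℂ) ^ (ν - 1) * g x) x := fun x hx => by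
    refine (hasDerivAt_macdonaldDefect ν hx).congr_deriv ?_
    rw [show ν - 1 = -(1 - ν) by ring, macdonaldDefect_neg _ hx]
  have hgd : ∀ x : ℝ, 0 < x → HasDerivAt g (-(x : ℂ) ^ (-ν) * f x) x := fun x hx => by
    refine (hasDerivAt_macdonaldDefect (1 - ν) hx).congr_deriv ?_
    rw [show 1 - ν - 1 = -ν by ring, macdonaldDefect_neg _ hx]
  have hWd : ∀ x : ℝ, 0 < x → HasDerivAt W (x ^ (a - 1) + x ^ (-a)) x := fun x hx => by
    have e1 := (Real.hasDerivAt_rpow_const (p := a) (Or.inl hx.ne')).div_const a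
    have e2 := (Real.hasDerivAt_rpow_const (p := 1 - a) (Or.inl hx.ne')).div_const (1 - a)
    refine (e1.add e2).congr_deriv ?_
    have : 1 - a ≠ 0 := by linarith
    rw [show 1 - a - 1 = -a by ring]
    field_simp
  have hφd : ∀ x : ℝ, 0 < x → HasDerivAt φ
      ((2 * inner ℝ (f x) (-(x : ℂ) ^ (ν - 1) * g x) + 2 * inner ℝ (g x) (-(x : ℂ) ^ (-ν) * f x)) *
        Real.exp (-W x) + (‖f x‖ ^ 2 + ‖g x‖ ^ 2) *
          (Real.exp (-W x) * -(x ^ (a - 1) + x ^ (-a)))) x := fun x hx =>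
    ((hfd x hx).norm_sq.add (hgd x hx).norm_sq).mul (hWd x hx).neg.exp
  have hanti : AntitoneOn φ (Ioi 0) := by
    refine antitoneOn_of_hasDerivWithinAt_nonpos (convex_Ioi 0)
      (fun x hx => (hφd x hx).continuousAt.continuousWithinAt)
      (fun x hx => (hφd x (by simpa using hx)).hasDerivWithinAt) fun x hx => ?_
    have hx : 0 < x := by simpa using hx
    have n1 : inner ℝ (f x) (-(x : ℂ) ^ (ν - 1) * g x) ≤ ‖f x‖ * (x ^ (a - 1) * ‖g x‖) := by
      refine (real_inner_le_norm _ _).trans (le_of_eq ?_)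
      rw [norm_mul, norm_neg, Complex.norm_cpow_eq_rpow_re_of_pos hx]
      simp [ha]
    have n2 : inner ℝ (g x) (-(x : ℂ) ^ (-ν) * f x) ≤ ‖g x‖ * (x ^ (-a) * ‖f x‖) := by
      refine (real_inner_le_norm _ _).trans (le_of_eq ?_)
      rw [norm_mul, norm_neg, Complex.norm_cpow_eq_rpow_re_of_pos hx]
      simp [ha]
    have hw : 0 ≤ x ^ (a - 1) + x ^ (-a) := by positivity
    have key : 2 * inner ℝ (f x) (-(x : ℂ) ^ (ν - 1) * g x) +
        2 * inner ℝ (g x) (-(x : ℂ) ^ (-ν) * f x) ≤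
        (‖f x‖ ^ 2 + ‖g x‖ ^ 2) * (x ^ (a - 1) + x ^ (-a)) := by
      -- Both cross terms together are at most `2‖f‖‖g‖ (x^(a-1) + x^(-a))`, and `2‖f‖‖g‖ ≤ ‖f‖² +
      -- ‖g‖²`.
      nlinarith [mul_nonneg hw (sq_nonneg (‖f x‖ - ‖g x‖))]
    have := mul_le_mul_of_nonneg_right key (Real.exp_pos (-W x)).le
    linarith
  have hlim : Tendsto φ (𝓝[>] 0) (𝓝 0) := by
    have t1 : Tendsto f (𝓝[>] 0) (𝓝 0) := tendsto_macdonaldDefect_zero h0 h1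
    have t2 : Tendsto g (𝓝[>] 0) (𝓝 0) :=
      tendsto_macdonaldDefect_zero (by simpa using h1) (by simpa using h0)
    have t3 : Tendsto W (𝓝[>] 0) (𝓝 (W 0)) := by
      have : Continuous W := ((Real.continuous_rpow_const h0.le).div_const a).add
        ((Real.continuous_rpow_const (by linarith)).div_const (1 - a))
      exact (this.tendsto 0).mono_left nhdsWithin_le_nhds
    have := ((t1.norm.pow 2).add (t2.norm.pow 2)).mul ((Real.continuous_exp.tendsto _).comp t3.neg)
    simpa using this
  have hle : φ q ≤ 0 := by
    refine ge_of_tendsto hlim ?_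
    filter_upwards [Ioo_mem_nhdsGT hq] with r hr
    exact hanti hr.1 hq hr.2.le
  have h2 : ‖f q‖ ^ 2 + ‖g q‖ ^ 2 ≤ 0 := by
    by_contra hcon
    exact absurd hle (not_le.2 (mul_pos (not_le.1 hcon) (Real.exp_pos _)))
  have h3 : ‖f q‖ ^ 2 = 0 := le_antisymm (by nlinarith [sq_nonneg ‖g q‖]) (sq_nonneg _)
  simpa using h3

/-- If `D_{ν+1}` vanishes for all `q > 0`, so does its derivative `D_ν`; this moves the vanishing
one strip to the left. -/
theorem macdonaldDefect_eq_zero_of_floor_nonpos (n : ℕ) :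
    ∀ {ν : ℂ}, -(n : ℝ) < ν.re → ν.re < 1 - n → ∀ {q : ℝ}, 0 < q → macdonaldDefect ν q = 0 := by
  induction n with
  | zero =>
    intro ν h0 h1 q hq
    exact macdonaldDefect_eq_zero_of_re_mem_Ioo (by simpa using h0) (by simpa using h1) hq
  | succ n ih =>
    intro ν h0 h1 q hq
    push_cast at h0 h1
    have hd := hasDerivAt_macdonaldDefect (ν + 1) hq
    rw [add_sub_cancel_right] at hd
    have hz : macdonaldDefect (ν + 1) =ᶠ[𝓝 q] fun _ => 0 := by
      filter_upwards [Ioi_mem_nhds hq] with x hx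
      exact ih (by simp; linarith) (by simp; linarith) hx
    exact hd.unique ((hasDerivAt_const q (0 : ℂ)).congr_of_eventuallyEq hz)

theorem macdonaldDefect_eq_zero_of_fract {ν : ℂ} (hν : (⌊ν.re⌋ : ℝ) < ν.re) {q : ℝ} (hq : 0 < q) :
    macdonaldDefect ν q = 0 := by
  have h1 := Int.lt_floor_add_one ν.re
  rcases le_or_gt ⌊ν.re⌋ 0 with h | h
  · obtain ⟨n, hn⟩ := Int.exists_eq_neg_ofNat h
    rw [hn] at hν h1
    push_cast at hν h1
    exact macdonaldDefect_eq_zero_of_floor_nonpos n hν (by linarith) hq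
  · obtain ⟨n, hn⟩ := Int.eq_ofNat_of_zero_le h.le
    rw [hn] at hν h1
    push_cast at hν h1
    -- From `n < Re ν < n + 1` the reflected order `-ν` lies in the strip with index `n + 1`.
    have hz := macdonaldDefect_eq_zero_of_floor_nonpos (n + 1) (ν := -ν)
      (by push_cast; simp; linarith) (by push_cast; simp; linarith) hq
    rw [← neg_neg ν, macdonaldDefect_neg _ hq, hz, mul_zero]

/-- The defect is continuous in the order, and `ν + ε` has non-integral real part for all small `ε >
0`. -/
theorem macdonaldDefect_eq_zero (ν : ℂ) {q : ℝ} (hq : 0 < q) : macdonaldDefect ν q = 0 := by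
  have hq' : (q : ℂ) ≠ 0 := by exact_mod_cast hq.ne'
  have hc : Continuous fun μ => macdonaldDefect μ q := by
    have h1 := continuous_macdonaldIntegral_order hq
    have h2 := continuous_besselClifford_order q
    have h3 : Continuous fun μ : ℂ => (q : ℂ) ^ μ := Continuous.const_cpow continuous_id (Or.inl hq')
    have h4 : Continuous fun μ : ℂ => besselClifford (-μ) q := h2.comp continuous_neg
    have h5 : Continuous fun μ : ℂ => Complex.sin (Real.pi * μ) := by fun_prop
    exact (h5.mul h1).sub (continuous_const.mul (h4.sub (h3.mul h2)))
  have hl : Tendsto (fun ε : ℝ => macdonaldDefect (ν + ε) q) (𝓝[>] 0) (𝓝 (macdonaldDefect ν q)) := by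
    have : Continuous fun ε : ℝ => macdonaldDefect (ν + ε) q := hc.comp (by fun_prop)
    have h := this.tendsto 0
    rw [Complex.ofReal_zero, add_zero] at h
    exact h.mono_left nhdsWithin_le_nhds
  refine tendsto_nhds_unique hl (tendsto_const_nhds.congr' ?_)
  have hp : 0 < (⌊ν.re⌋ : ℝ) + 1 - ν.re := by linarith [Int.lt_floor_add_one ν.re]
  filter_upwards [Ioo_mem_nhdsGT hp] with ε hε
  refine (macdonaldDefect_eq_zero_of_fract ?_ hq).symm
  have h1 := Int.floor_le ν.re
  have h2 : ⌊(ν + ε).re⌋ = ⌊ν.re⌋ := by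
    rw [Int.floor_eq_iff]
    simp
    constructor <;> linarith [hε.1, hε.2]
  rw [h2]
  simp
  linarith [hε.1]

theorem besselKQuot_eq {ν : ℂ} (hν : ¬∃ j : ℤ, ν = j) {x : ℝ} (hx : 0 < x) :
    besselKQuot ν x = 1 / 2 * ((x / 2 : ℝ) : ℂ) ^ (-ν) * macdonaldIntegral ν ((x / 2) ^ 2) := by
  have hx2 : 0 < x / 2 := half_pos hx
  have hx' : ((x / 2 : ℝ) : ℂ) ≠ 0 := by exact_mod_cast hx2.ne'
  have hpi : (Real.pi : ℂ) ≠ 0 := by exact_mod_cast Real.pi_ne_zero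
  have hs : Complex.sin (Real.pi * ν) ≠ 0 := by
    rw [Ne, Complex.sin_eq_zero_iff]
    rintro ⟨j, hj⟩
    refine hν ⟨j, ?_⟩
    rw [mul_comm] at hj
    exact mul_right_cancel₀ hpi hj
  have hd := macdonaldDefect_eq_zero ν (q := (x / 2) ^ 2) (by positivity)
  rw [macdonaldDefect, sub_eq_zero] at hd
  have hpow : (((x / 2) ^ 2 : ℝ) : ℂ) ^ ν = ((x / 2 : ℝ) : ℂ) ^ ν * ((x / 2 : ℝ) : ℂ) ^ ν := by
    rw [sq, Complex.ofReal_mul, Complex.mul_cpow_ofReal_nonneg hx2.le hx2.le]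
  have hinv : ((x / 2 : ℝ) : ℂ) ^ (-ν) * ((x / 2 : ℝ) : ℂ) ^ ν = 1 := by
    rw [← Complex.cpow_add _ _ hx', neg_add_cancel, Complex.cpow_zero]
  rw [hpow] at hd
  rw [besselKQuot, besselI_eq _ hx, besselI_eq _ hx, mul_comm ν, ← mul_div_assoc, div_eq_iff hs]
  linear_combination (-(1 / 2 : ℂ) * ((x / 2 : ℝ) : ℂ) ^ (-ν)) * hd +
    (Real.pi / 2 : ℂ) * ((x / 2 : ℝ) : ℂ) ^ ν * besselClifford ν (((x / 2) ^ 2 : ℝ) : ℂ) * hinv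

/-- The integral representation of the modified Bessel function of the third kind. -/
theorem besselK_eq (ν : ℂ) {x : ℝ} (hx : 0 < x) :
    besselK ν x = 1 / 2 * ((x / 2 : ℝ) : ℂ) ^ (-ν) * macdonaldIntegral ν ((x / 2) ^ 2) := by
  rw [besselK]
  split_ifs with h
  -- At an integer the right-hand side is continuous in the order and equals the quotient on a
  -- punctured unit ball, which contains no integer.
  · refine Tendsto.limUnder_eq ?_
    have hx' : ((x / 2 : ℝ) : ℂ) ≠ 0 := by exact_mod_cast (half_pos hx).ne'
    have hc : Continuous fun μ : ℂ =>
        1 / 2 * ((x / 2 : ℝ) : ℂ) ^ (-μ) * macdonaldIntegral μ ((x / 2) ^ 2) :=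
      (continuous_const.mul (Continuous.const_cpow continuous_neg (Or.inl hx'))).mul
        (continuous_macdonaldIntegral_order (by positivity))
    refine ((hc.tendsto ν).mono_left nhdsWithin_le_nhds).congr' ?_
    obtain ⟨j, rfl⟩ := h
    have hball : Metric.ball (j : ℂ) 1 ∈ 𝓝[≠] (j : ℂ) :=
      mem_nhdsWithin_of_mem_nhds (Metric.ball_mem_nhds _ one_pos)
    filter_upwards [hball, self_mem_nhdsWithin] with μ hμ hne
    refine (besselKQuot_eq ?_ hx).symm
    rintro ⟨i, rfl⟩
    rw [Metric.mem_ball, dist_eq_norm, ← Int.cast_sub, Complex.norm_intCast] at hμ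
    have h1 : |i - j| < 1 := by exact_mod_cast hμ
    exact hne (by rw [mem_singleton_iff, sub_eq_zero.1 (Int.abs_lt_one_iff.1 h1)])
  · exact besselKQuot_eq h hx

end

section

/-! ### Gaussian integrals over `ℂ` and `ℂᵐ` -/

theorem integral_norm_pow_mul_exp_neg (j : ℕ) {b : ℝ} (hb : 0 < b) :
    ∫ τ : ℂ, ‖τ‖ ^ j * Real.exp (-(b * ‖τ‖ ^ 2)) =
      Real.pi * b ^ (-((j : ℝ) / 2 + 1)) * Real.Gamma ((j : ℝ) / 2 + 1) := by
  have h := Complex.integral_rpow_mul_exp_neg_mul_rpow (p := 2) (q := j) (b := b) (by norm_num)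
    (by have : (0 : ℝ) ≤ j := Nat.cast_nonneg j
        linarith) hb
  simp only [Real.rpow_natCast, Real.rpow_two, neg_mul] at h
  rw [h, show -((j : ℝ) + 2) / 2 = -((j : ℝ) / 2 + 1) by ring,
    show ((j : ℝ) + 2) / 2 = (j : ℝ) / 2 + 1 by ring]
  ring

/-- A non-integrable function would have integral `0` by convention, whereas the computed value is
positive. -/
theorem integrable_norm_pow_mul_exp_neg (j : ℕ) {b : ℝ} (hb : 0 < b) :
    Integrable fun τ : ℂ => ‖τ‖ ^ j * Real.exp (-(b * ‖τ‖ ^ 2)) := by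
  by_contra h
  have h1 := integral_undef h
  rw [integral_norm_pow_mul_exp_neg j hb] at h1
  have h2 : 0 < Real.Gamma ((j : ℝ) / 2 + 1) := Real.Gamma_pos_of_pos (by positivity)
  have h3 := Real.pi_pos
  have h4 : 0 < b ^ (-((j : ℝ) / 2 + 1)) := by positivity
  exact absurd h1 (by positivity)

/-- The character `exp (- 2 i π r)`. -/
def phase (r : ℝ) : ℂ := Complex.exp (-2 * Complex.I * (Real.pi : ℂ) * (r : ℂ))

theorem norm_phase (r : ℝ) : ‖phase r‖ = 1 := by
  rw [phase, show -2 * Complex.I * (Real.pi : ℂ) * (r : ℂ) = ((-2 * Real.pi * r : ℝ) : ℂ) * Complex.I by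
    push_cast; ring, Complex.norm_exp_ofReal_mul_I]

theorem phase_add (r s : ℝ) : phase (r + s) = phase r * phase s := by
  rw [phase, phase, phase, ← Complex.exp_add]
  push_cast
  ring_nf

theorem phase_sum {ι : Type*} (t : Finset ι) (f : ι → ℝ) :
    phase (∑ i ∈ t, f i) = ∏ i ∈ t, phase (f i) := by
  simp only [phase, ← Complex.exp_sum, Complex.ofReal_sum, Finset.mul_sum]

@[fun_prop]
theorem continuous_phase : Continuous phase := by
  unfold phase; fun_prop

theorem integral_exp_neg_mul_phase {b : ℝ} (hb : 0 < b) (s : ℂ) :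
    ∫ τ : ℂ, (Real.exp (-(b * ‖τ‖ ^ 2)) : ℂ) * phase (s * τ).re =
      (Real.pi / b : ℝ) * (Real.exp (-(Real.pi ^ 2 * ‖s‖ ^ 2 / b)) : ℂ) := by
  have h := GaussianFourier.integral_cexp_neg_mul_sq_norm_add (V := ℂ) (b := (b : ℂ))
    (by simpa using hb) (-2 * Complex.I * (Real.pi : ℂ)) ((starRingEnd ℂ) s)
  rw [Complex.finrank_real_complex] at h
  have e : ∀ τ : ℂ, (Real.exp (-(b * ‖τ‖ ^ 2)) : ℂ) * phase (s * τ).re =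
      Complex.exp (-(b : ℂ) * (‖τ‖ : ℂ) ^ 2 +
        -2 * Complex.I * (Real.pi : ℂ) * ((inner ℝ ((starRingEnd ℂ) s) τ : ℝ) : ℂ)) := by
    intro τ
    rw [Complex.exp_add, phase, Complex.inner, Complex.conj_conj, mul_comm τ s]
    push_cast
    ring_nf
  simp only [e]
  rw [h]
  push_cast
  rw [div_self (two_ne_zero' ℂ), Complex.cpow_one, Complex.norm_conj]
  congr 2
  have hb' : (b : ℂ) ≠ 0 := by exact_mod_cast hb.ne'
  field_simp
  rw [Complex.I_sq]
  ring

theorem integrable_pow_mul_exp_neg_mul_phase (j : ℕ) {b : ℝ} (hb : 0 < b) (s : ℂ) :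
    Integrable fun τ : ℂ => τ ^ j * ((Real.exp (-(b * ‖τ‖ ^ 2)) : ℂ) * phase (s * τ).re) := by
  refine (integrable_norm_pow_mul_exp_neg j hb).mono'
    (Continuous.aestronglyMeasurable (by fun_prop)) (Eventually.of_forall fun τ => ?_)
  rw [norm_mul, norm_mul, norm_phase, norm_pow, mul_one, Complex.norm_real,
    Real.norm_of_nonneg (Real.exp_pos _).le]

theorem hasLineDerivAt_exp_neg_mul_phase (b : ℝ) (s τ v : ℂ) :
    HasLineDerivAt ℝ (fun τ : ℂ => (Real.exp (-(b * ‖τ‖ ^ 2)) : ℂ) * phase (s * τ).re)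
      (((-(2 * b * (τ * (starRingEnd ℂ) v).re) : ℝ) - 2 * Complex.I * Real.pi * ((s * v).re : ℝ)) *
        ((Real.exp (-(b * ‖τ‖ ^ 2)) : ℂ) * phase (s * τ).re)) τ v := by
  rw [HasLineDerivAt]
  have e1 : ∀ t : ℝ, ‖τ + t • v‖ ^ 2 = ‖τ‖ ^ 2 + 2 * t * (τ * (starRingEnd ℂ) v).re + t ^ 2 * ‖v‖ ^ 2 := by
    intro t
    simp only [← Complex.normSq_eq_norm_sq, Complex.normSq_apply]
    simp
    ring
  have e2 : ∀ t : ℝ, (s * (τ + t • v)).re = (s * τ).re + t * (s * v).re := by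
    intro t; simp; ring
  have e3 : ∀ t : ℝ, (Real.exp (-(b * ‖τ + t • v‖ ^ 2)) : ℂ) * phase (s * (τ + t • v)).re =
      Complex.exp (((-(b * (‖τ‖ ^ 2 + 2 * t * (τ * (starRingEnd ℂ) v).re + t ^ 2 * ‖v‖ ^ 2)) : ℝ) : ℂ)
        + -2 * Complex.I * Real.pi * (((s * τ).re + t * (s * v).re : ℝ) : ℂ)) := by
    intro t
    rw [e1, e2, phase, Complex.ofReal_exp, ← Complex.exp_add]
  have e4 : (Real.exp (-(b * ‖τ‖ ^ 2)) : ℂ) * phase (s * τ).re =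
      Complex.exp (((-(b * (‖τ‖ ^ 2 + 2 * 0 * (τ * (starRingEnd ℂ) v).re + 0 ^ 2 * ‖v‖ ^ 2)) : ℝ) : ℂ)
        + -2 * Complex.I * Real.pi * (((s * τ).re + 0 * (s * v).re : ℝ) : ℂ)) := by
    have := e3 0
    simpa using this
  simp only [e3]
  rw [e4]
  have d1 : HasDerivAt (fun t : ℝ =>
      -(b * (‖τ‖ ^ 2 + 2 * t * (τ * (starRingEnd ℂ) v).re + t ^ 2 * ‖v‖ ^ 2)))
      (-(2 * b * (τ * (starRingEnd ℂ) v).re)) 0 := by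
    have := ((((((hasDerivAt_id (0 : ℝ)).const_mul 2).mul_const (τ * (starRingEnd ℂ) v).re).const_add
      (‖τ‖ ^ 2)).add ((hasDerivAt_pow 2 (0 : ℝ)).mul_const (‖v‖ ^ 2))).const_mul b).neg
    refine this.congr_deriv ?_
    simp
    ring
  have d2 : HasDerivAt (fun t : ℝ => (s * τ).re + t * (s * v).re) (s * v).re 0 := by
    have := ((hasDerivAt_id (0 : ℝ)).mul_const (s * v).re).const_add (s * τ).re
    simpa using this
  refine ((d1.ofReal_comp.add (d2.ofReal_comp.const_mul (-2 * Complex.I * Real.pi))).cexp).congr_deriv ?_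
  simp only [Pi.add_apply]
  ring

theorem hasLineDerivAt_pow (j : ℕ) (τ v : ℂ) :
    HasLineDerivAt ℝ (fun τ : ℂ => τ ^ j) ((j : ℂ) * τ ^ (j - 1) * v) τ v := by
  have h := ((hasDerivAt_pow j τ).hasFDerivAt.restrictScalars ℝ).hasLineDerivAt v
  refine h.congr_deriv ?_
  simp [mul_comm]

/-- Integration by parts against `∂/∂τ̄`: it annihilates the holomorphic factor `τ^j` and multiplies
the Gaussian with phase by `-(bτ + iπ s̄)`. -/
theorem integral_pow_succ_mul_exp_neg_mul_phase (j : ℕ) {b : ℝ} (hb : 0 < b) (s : ℂ) :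
    ∫ τ : ℂ, τ ^ (j + 1) * ((Real.exp (-(b * ‖τ‖ ^ 2)) : ℂ) * phase (s * τ).re) =
      (-Complex.I * Real.pi * (starRingEnd ℂ) s / b) *
        ∫ τ : ℂ, τ ^ j * ((Real.exp (-(b * ‖τ‖ ^ 2)) : ℂ) * phase (s * τ).re) := by
  set G : ℂ → ℂ := fun τ => (Real.exp (-(b * ‖τ‖ ^ 2)) : ℂ) * phase (s * τ).re with hG
  have hi : ∀ i : ℕ, Integrable fun τ => τ ^ i * G τ :=
    fun i => integrable_pow_mul_exp_neg_mul_phase i hb s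
  have hlin : ∀ r : ℂ → ℝ, Continuous r → (∀ τ, |r τ| ≤ ‖τ‖) →
      Integrable fun τ : ℂ => ((2 * b * r τ : ℝ) : ℂ) * (τ ^ j * G τ) := by
    intro r hr hle
    refine ((hi (j + 1)).norm.const_mul (2 * b)).mono'
      (Continuous.aestronglyMeasurable (by simp only [hG]; fun_prop)) (Eventually.of_forall fun τ => ?_)
    have h1 : ‖((2 * b * r τ : ℝ) : ℂ)‖ = 2 * b * |r τ| := by
      rw [Complex.norm_real, Real.norm_eq_abs, abs_mul, abs_of_pos (by positivity)]
    calc ‖((2 * b * r τ : ℝ) : ℂ) * (τ ^ j * G τ)‖ = 2 * b * |r τ| * (‖τ‖ ^ j * ‖G τ‖) := by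
          rw [norm_mul, h1, norm_mul, norm_pow]
      _ ≤ 2 * b * ‖τ‖ * (‖τ‖ ^ j * ‖G τ‖) := by gcongr; exact hle τ
      _ = 2 * b * ‖τ ^ (j + 1) * G τ‖ := by rw [norm_mul (τ ^ (j + 1)), norm_pow]; ring
  have hre : Integrable fun τ : ℂ => ((2 * b * τ.re : ℝ) : ℂ) * (τ ^ j * G τ) :=
    hlin _ Complex.continuous_re Complex.abs_re_le_norm
  have him : Integrable fun τ : ℂ => ((2 * b * τ.im : ℝ) : ℂ) * (τ ^ j * G τ) :=
    hlin _ Complex.continuous_im Complex.abs_im_le_norm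
  -- Integration by parts in the real direction `v`. The truncated exponent `j - 1` at `j = 0` is
  -- multiplied by `j = 0`.
  have hibp : ∀ v : ℂ, Integrable (fun τ : ℂ => ((2 * b * (τ * (starRingEnd ℂ) v).re : ℝ) : ℂ) * (τ ^ j * G τ)) →
      ∫ τ : ℂ, (((2 * b * (τ * (starRingEnd ℂ) v).re : ℝ) : ℂ) + 2 * Complex.I * Real.pi * ((s * v).re : ℝ)) *
        (τ ^ j * G τ) = (j * v) * ∫ τ : ℂ, τ ^ (j - 1) * G τ := by
    intro v hv
    have hl := integral_bilinear_hasLineDerivAt_right_eq_neg_left_of_integrable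
      (B := ContinuousLinearMap.mul ℝ ℂ) (μ := (volume : Measure ℂ)) (v := v)
      (f := fun τ : ℂ => τ ^ j) (f' := fun τ => (j : ℂ) * τ ^ (j - 1) * v)
      (g := G) (g' := fun τ =>
        ((-(2 * b * (τ * (starRingEnd ℂ) v).re) : ℝ) - 2 * Complex.I * Real.pi * ((s * v).re : ℝ)) * G τ)
      (by
        refine ((hi (j - 1)).const_mul (j * v)).congr (Eventually.of_forall fun τ => ?_)
        simp only [ContinuousLinearMap.mul_apply']; ring)
      (by
        refine ((hv.neg).sub ((hi j).const_mul (2 * Complex.I * Real.pi * ((s * v).re : ℝ)))).congr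
          (Eventually.of_forall fun τ => ?_)
        simp only [ContinuousLinearMap.mul_apply', Pi.sub_apply, Pi.neg_apply]; push_cast; ring)
      (by simpa using hi j)
      (fun τ _ => hasLineDerivAt_pow j τ v) (fun τ _ => hasLineDerivAt_exp_neg_mul_phase b s τ v)
    simp only [ContinuousLinearMap.mul_apply'] at hl
    rw [← integral_const_mul, ← neg_inj, ← integral_neg]
    refine Eq.trans (integral_congr_ae (Eventually.of_forall fun τ => ?_))
      (hl.trans (congrArg Neg.neg (integral_congr_ae (Eventually.of_forall fun τ => ?_))))
    · push_cast; ring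
    · ring
  have h1 := hibp 1 (by simpa using hre)
  have h2 := hibp Complex.I (by simpa using him)
  have hsum : ∫ τ : ℂ, (2 * b * (τ ^ (j + 1) * G τ) +
      2 * Complex.I * Real.pi * (starRingEnd ℂ) s * (τ ^ j * G τ)) = 0 := by
    -- Direction `1` plus `i` times direction `i` is `2 ∂/∂τ̄`; the contributions of `τ^j` cancel
    -- since `1 + i² = 0`.
    have h3 : ((j : ℂ) * 1 * ∫ τ : ℂ, τ ^ (j - 1) * G τ) +
        Complex.I * ((j : ℂ) * Complex.I * ∫ τ : ℂ, τ ^ (j - 1) * G τ) = 0 := by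
      linear_combination ((j : ℂ) * ∫ τ : ℂ, τ ^ (j - 1) * G τ) * Complex.I_sq
    rw [← h1, ← h2, ← integral_const_mul, ← integral_add] at h3
    · rw [← h3]
      refine integral_congr_ae (Eventually.of_forall fun τ => ?_)
      have r1 : (τ.re : ℂ) + Complex.I * τ.im = τ := by rw [mul_comm]; exact Complex.re_add_im τ
      have r2 : (starRingEnd ℂ) s = (s.re : ℂ) - Complex.I * s.im := by
        apply Complex.ext <;> simp
      simp only [r2, map_one, mul_one, Complex.conj_I, Complex.mul_re, Complex.I_re, Complex.I_im,
        Complex.neg_re, Complex.neg_im]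
      push_cast
      linear_combination (-2 * b * (τ ^ j * G τ)) * r1
    · refine (hre.add ((hi j).const_mul (2 * Complex.I * Real.pi * ((s * 1).re : ℝ)))).congr
        (Eventually.of_forall fun τ => ?_)
      simp only [Pi.add_apply, map_one, mul_one]; ring
    · refine Integrable.const_mul ?_ _
      refine (him.add ((hi j).const_mul (2 * Complex.I * Real.pi * ((s * Complex.I).re : ℝ)))).congr
        (Eventually.of_forall fun τ => ?_)
      simp; ring
  rw [integral_add ((hi (j + 1)).const_mul _) ((hi j).const_mul _), integral_const_mul,
    integral_const_mul] at hsum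
  have hb' : (b : ℂ) ≠ 0 := by exact_mod_cast hb.ne'
  change ∫ τ : ℂ, τ ^ (j + 1) * G τ = _ * ∫ τ : ℂ, τ ^ j * G τ
  rw [div_mul_eq_mul_div, eq_div_iff hb']
  linear_combination hsum / 2

theorem integral_pow_mul_exp_neg_mul_phase (j : ℕ) {b : ℝ} (hb : 0 < b) (s : ℂ) :
    ∫ τ : ℂ, τ ^ j * ((Real.exp (-(b * ‖τ‖ ^ 2)) : ℂ) * phase (s * τ).re) =
      (-Complex.I * Real.pi * (starRingEnd ℂ) s / b) ^ j *
        ((Real.pi / b : ℝ) * (Real.exp (-(Real.pi ^ 2 * ‖s‖ ^ 2 / b)) : ℂ)) := by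
  induction j with
  | zero => simpa using integral_exp_neg_mul_phase hb s
  | succ j ih => rw [integral_pow_succ_mul_exp_neg_mul_phase j hb, ih, pow_succ]; ring

theorem exp_neg_mul_sqNorm {m : ℕ} (b : ℝ) (ξ : Fin m → ℂ) :
    Real.exp (-(b * sqNorm ξ)) = ∏ i, Real.exp (-(b * ‖ξ i‖ ^ 2)) := by
  rw [← Real.exp_sum, sqNorm, Finset.mul_sum, Finset.sum_neg_distrib]

theorem integrable_exp_neg_mul_sqNorm {m : ℕ} {b : ℝ} (hb : 0 < b) :
    Integrable fun ξ : Fin m → ℂ => Real.exp (-(b * sqNorm ξ)) := by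
  simp only [exp_neg_mul_sqNorm]
  refine Integrable.fintype_prod (f := fun _ (x : ℂ) => Real.exp (-(b * ‖x‖ ^ 2))) fun i => ?_
  simpa using integrable_norm_pow_mul_exp_neg 0 hb

theorem integral_exp_neg_mul_sqNorm {m : ℕ} {b : ℝ} (hb : 0 < b) :
    ∫ ξ : Fin m → ℂ, Real.exp (-(b * sqNorm ξ)) = (Real.pi / b) ^ m := by
  simp only [exp_neg_mul_sqNorm]
  rw [integral_fintype_prod_volume_eq_pow (fun x : ℂ => Real.exp (-(b * ‖x‖ ^ 2))), Fintype.card_fin]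
  congr 1
  have := integral_norm_pow_mul_exp_neg 0 hb
  simpa [Real.rpow_neg_one, div_eq_mul_inv] using this

theorem integral_exp_neg_mul_sqNorm_mul_phase {m : ℕ} {b : ℝ} (hb : 0 < b) (v : Fin m → ℂ) :
    ∫ ξ : Fin m → ℂ, (Real.exp (-(b * sqNorm ξ)) : ℂ) * phase (∑ i, v i * ξ i).re =
      (Real.pi / b : ℝ) ^ m * (Real.exp (-(Real.pi ^ 2 * sqNorm v / b)) : ℂ) := by
  have e : ∀ ξ : Fin m → ℂ, (Real.exp (-(b * sqNorm ξ)) : ℂ) * phase (∑ i, v i * ξ i).re =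
      ∏ i, ((Real.exp (-(b * ‖ξ i‖ ^ 2)) : ℂ) * phase (v i * ξ i).re) := by
    intro ξ
    rw [exp_neg_mul_sqNorm, Complex.re_sum, phase_sum, Finset.prod_mul_distrib, Complex.ofReal_prod]
  simp only [e]
  rw [integral_fintype_prod_volume_eq_prod
    (fun i (x : ℂ) => (Real.exp (-(b * ‖x‖ ^ 2)) : ℂ) * phase (v i * x).re)]
  simp only [integral_exp_neg_mul_phase hb]
  rw [Finset.prod_mul_distrib, Finset.prod_const, Finset.card_univ, Fintype.card_fin,
    ← Complex.ofReal_prod, ← Real.exp_sum, Finset.sum_neg_distrib, sqNorm, Finset.mul_sum,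
    Finset.sum_div]

end

/-! ### Harmonicity, weights, and uniqueness of the highest weight vector. -/

section
open MvPolynomial

/-- Euler operators are diagonal on monomials, which lets Cartan weights be read off coefficient by
coefficient. -/
theorem coeff_pderiv_mul_X {σ : Type*} (i : σ) (P : MvPolynomial σ ℂ) (d : σ →₀ ℕ) :
    coeff d (pderiv i P * X i) = (d i : ℂ) * coeff d P := by
  classical
  induction P using MvPolynomial.induction_on' with
  | monomial e a =>
    have h : pderiv i (monomial e a) * X i = monomial e (a * e i) := by
      rw [pderiv_monomial, X, monomial_mul, mul_one]
      rcases Nat.eq_zero_or_pos (e i) with h | h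
      · simp [h]
      · congr 2
        ext j
        by_cases hj : i = j
        · subst hj; simp; omega
        · simp [hj]
    rw [h, coeff_monomial, coeff_monomial]
    split_ifs with hd
    · rw [hd]; ring
    · simp
  | add p q hp hq => simp only [map_add, add_mul, coeff_add, hp, hq, mul_add]

theorem dL_cartan {n : ℕ} (h : Fin n → ℂ) (P : ZPoly n) :
    dL (cartan h) P =
      -(∑ i : Idx n, C (Sum.elim h (fun r => -h r) i) * (pderiv (Sum.inl i) P * X (Sum.inl i))) +
        ∑ i : Idx n, C (Sum.elim h (fun r => -h r) i) * (pderiv (Sum.inr i) P * X (Sum.inr i)) := by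
  classical
  have e1 : ∀ (i : Idx n) (f : Idx n → ZPoly n),
      ∑ j, C (cartan h i j) * f j = C (Sum.elim h (fun r => -h r) i) * f i := by
    intro i f
    rw [Finset.sum_eq_single i]
    · rw [cartan, Matrix.diagonal_apply_eq]
    · intro j _ hj
      rw [cartan, Matrix.diagonal_apply_ne _ hj.symm, C_0, zero_mul]
    · simp
  have e2 : ∀ (i : Idx n) (f : Idx n → ZPoly n),
      ∑ j, C (cartan h j i) * f j = C (Sum.elim h (fun r => -h r) i) * f i := by
    intro i f
    rw [Finset.sum_eq_single i]
    · rw [cartan, Matrix.diagonal_apply_eq]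
    · intro j _ hj
      rw [cartan, Matrix.diagonal_apply_ne _ hj, C_0, zero_mul]
    · simp
  rw [dL, ← Finset.sum_neg_distrib]
  congr 1
  · refine Finset.sum_congr rfl fun i _ => ?_
    rw [e1 i fun j => X (Sum.inl j)]; ring
  · refine Finset.sum_congr rfl fun i _ => ?_
    rw [e2 i fun j => X (Sum.inr j)]; ring

/-- The exponent of the monomial `w_1 ^ α * conj(z_1) ^ β`. -/
def expP0 (m α β : ℕ) : (Idx (m + 1) ⊕ Idx (m + 1)) →₀ ℕ :=
  Finsupp.single (Sum.inl (Sum.inr 0)) α + Finsupp.single (Sum.inr (Sum.inl 0)) β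

theorem P0_eq_monomial (m α β : ℕ) : P0 m α β = monomial (expP0 m α β) 1 := by
  rw [P0, X_pow_eq_monomial, X_pow_eq_monomial, monomial_mul, one_mul, expP0]

theorem P0_ne_zero (m α β : ℕ) : P0 m α β ≠ 0 := by
  rw [P0_eq_monomial]; simp

theorem pderiv_P0_eq_zero {m : ℕ} (α β : ℕ) {i : Idx (m + 1) ⊕ Idx (m + 1)}
    (h1 : i ≠ Sum.inl (Sum.inr 0)) (h2 : i ≠ Sum.inr (Sum.inl 0)) : pderiv i (P0 m α β) = 0 := by
  rw [P0_eq_monomial, pderiv_monomial]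
  simp [expP0, h1.symm, h2.symm]

/-- Only `w_1` and `conj z_1` occur, and they belong to different coordinates, so every mixed
derivative in the Laplacian is zero. -/
theorem isHarm_P0 (m α β : ℕ) : IsHarm α β (P0 m α β) where
  bihomogeneous d hd := by
    rw [P0_eq_monomial] at hd
    have hd' := support_monomial_subset hd
    rw [Finset.mem_singleton] at hd'
    subst hd'
    constructor <;> simp [expP0, Finsupp.single_apply]
  harmonic := by
    rw [Finset.sum_eq_zero, mul_zero]
    intro i _
    rcases i with r | r
    · by_cases hr : r = 0
      · subst hr
        have : pderiv (Sum.inl (Sum.inl 0)) (P0 m α β) = 0 :=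
          pderiv_P0_eq_zero α β (by simp) (by simp)
        rw [P0] at this ⊢
        simp [Derivation.leibniz, Derivation.leibniz_pow, pderiv_X]
      · rw [pderiv_P0_eq_zero α β (i := Sum.inr (Sum.inl r)) (by simp) (by simpa using hr), map_zero]
    · rw [pderiv_P0_eq_zero α β (i := Sum.inr (Sum.inr r)) (by simp) (by simp), map_zero]

/-- The derivative in `w_1` is paired with row `w_1` of the matrix, the one in `conj z_1` with
column `z_1`. The positive root vectors have both equal to zero. -/
theorem dL_P0 {m : ℕ} (α β : ℕ) (Y : Matrix (Idx (m + 1)) (Idx (m + 1)) ℂ)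
    (hrow : ∀ j, Y (Sum.inr 0) j = 0) (hcol : ∀ j, Y j (Sum.inl 0) = 0) :
    dL Y (P0 m α β) = 0 := by
  rw [dL, Finset.sum_eq_zero, Finset.sum_eq_zero, add_zero]
  · intro i _
    by_cases hi : i = Sum.inl 0
    · subst hi; simp [hcol]
    · rw [pderiv_P0_eq_zero α β (by simp) (by simpa using hi), zero_mul]
  · intro i _
    by_cases hi : i = Sum.inr 0
    · subst hi; simp [hrow]
    · rw [pderiv_P0_eq_zero α β (by simpa using hi) (by simp), zero_mul]

/-- The weight of a monomial under the diagonal Cartan subalgebra. -/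
theorem coeff_dL_cartan {n : ℕ} (h : Fin n → ℂ) (P : ZPoly n) (d : (Idx n ⊕ Idx n) →₀ ℕ) :
    coeff d (dL (cartan h) P) =
      (∑ i : Idx n, Sum.elim h (fun r => -h r) i * ((d (Sum.inr i) : ℂ) - d (Sum.inl i))) *
        coeff d P := by
  rw [dL_cartan, coeff_add, coeff_neg, coeff_sum, coeff_sum, Finset.sum_mul]
  simp only [coeff_C_mul, coeff_pderiv_mul_X]
  rw [← Finset.sum_neg_distrib, ← Finset.sum_add_distrib]
  refine Finset.sum_congr rfl fun i _ => ?_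
  ring

theorem isHighestWeightVector_P0 (m α β : ℕ) :
    IsHighestWeightVector (Pi.single 0 ((α + β : ℕ) : ℤ)) (P0 m α β) where
  ne_zero := P0_ne_zero m α β
  weight h := by
    classical
    ext d
    rw [coeff_dL_cartan, coeff_C_mul, P0_eq_monomial, coeff_monomial]
    split_ifs with hd
    · subst hd
      congr 1
      rw [Fintype.sum_sum_type, Finset.sum_eq_single 0, Finset.sum_eq_single 0,
        Finset.sum_eq_single 0]
      · simp [expP0]; ring
      all_goals simp +contextual [expP0, eq_comm]
    · simp
  annihilated_U r s hrs := by
    have hs : s ≠ 0 := (Fin.pos_of_ne_zero (by rintro rfl; exact absurd hrs (by simp))).ne'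
    refine dL_P0 α β _ (fun j => ?_) fun j => ?_ <;>
      simp [rootU, hs]
  annihilated_V r s hrs := by
    refine dL_P0 α β _ (fun j => ?_) fun j => ?_ <;>
      simp [rootV]
  annihilated_D r := by
    refine dL_P0 α β _ (fun j => ?_) fun j => ?_ <;>
      simp [rootD]

/-- A highest weight vector of weight `(α + β, 0, …, 0)` is a multiple of `w_1 ^ α conj(z_1) ^ β`. -/
theorem eq_C_mul_P0 {m α β : ℕ} {P : ZPoly (m + 1)} (hP : IsHarm α β P)
    (hw : IsHighestWeightVector (Pi.single 0 ((α + β : ℕ) : ℤ)) P) :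
    ∃ c : ℂ, c ≠ 0 ∧ P = C c * P0 m α β := by
  classical
  have hsupp : ∀ d ∈ P.support, d = expP0 m α β := by
    intro d hd
    obtain ⟨h1, h2⟩ := hP.bihomogeneous d hd
    -- The `L_1`-weight reads `deg conj z_1 - deg z_1 - deg conj w_1 + deg w_1 = α + β`. As `deg w_1
    -- ≤ α` and `deg conj z_1 ≤ β`, both are equalities, and the bidegree excludes every other
    -- variable.
    have hc := congrArg (coeff d) (hw.weight (Pi.single 0 1))
    rw [coeff_dL_cartan, coeff_C_mul] at hc
    have hc := mul_right_cancel₀ (mem_support_iff.1 hd) hc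
    rw [Fintype.sum_sum_type, Finset.sum_eq_single 0, Finset.sum_eq_single 0,
      Finset.sum_eq_single 0] at hc
    rotate_left
    iterate 6 simp +contextual [Pi.single_apply]
    simp only [Sum.elim_inl, Sum.elim_inr, Pi.single_eq_same, one_mul, mul_one] at hc
    have hc' : (d (Sum.inr (Sum.inl 0)) : ℤ) - d (Sum.inl (Sum.inl 0)) -
        (d (Sum.inr (Sum.inr 0)) - d (Sum.inl (Sum.inr 0))) = ((α + β : ℕ) : ℤ) := by
      have : (((d (Sum.inr (Sum.inl 0)) : ℤ) - d (Sum.inl (Sum.inl 0)) -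
        (d (Sum.inr (Sum.inr 0)) - d (Sum.inl (Sum.inr 0))) : ℤ) : ℂ) = (((α + β : ℕ) : ℤ) : ℂ) := by
        push_cast at hc ⊢
        linear_combination hc
      exact_mod_cast this
    have l1 : d (Sum.inl (Sum.inr 0)) ≤ α := h1 ▸ Finset.single_le_sum
      (f := fun i : Idx (m + 1) => d (Sum.inl i)) (fun _ _ => Nat.zero_le _) (Finset.mem_univ _)
    have l2 : d (Sum.inr (Sum.inl 0)) ≤ β := h2 ▸ Finset.single_le_sum
      (f := fun i : Idx (m + 1) => d (Sum.inr i)) (fun _ _ => Nat.zero_le _) (Finset.mem_univ _)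
    have q1 : d (Sum.inl (Sum.inr 0)) = α := by push_cast at hc'; omega
    have q2 : d (Sum.inr (Sum.inl 0)) = β := by push_cast at hc'; omega
    rw [← Finset.add_sum_erase _ _ (Finset.mem_univ (Sum.inr 0)), q1, Nat.add_eq_left,
      Finset.sum_eq_zero_iff] at h1
    rw [← Finset.add_sum_erase _ _ (Finset.mem_univ (Sum.inl 0)), q2, Nat.add_eq_left,
      Finset.sum_eq_zero_iff] at h2
    ext i
    rcases i with i | i
    · by_cases hi : i = Sum.inr 0
      · subst hi; simp [expP0, q1]
      · rw [h1 i (by simp [hi])]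
        simp [expP0, Ne.symm hi]
    · by_cases hi : i = Sum.inl 0
      · subst hi; simp [expP0, q2]
      · rw [h2 i (by simp [hi])]
        simp [expP0, Ne.symm hi]
  have hPe : P = C (coeff (expP0 m α β) P) * P0 m α β := by
    ext d
    rw [coeff_C_mul, P0_eq_monomial, coeff_monomial]
    split_ifs with hd
    · rw [hd, mul_one]
    · rw [mul_zero]
      by_contra hne
      exact hd (hsupp d (mem_support_iff.2 hne)).symm
  refine ⟨_, fun h0 => hw.ne_zero ?_, hPe⟩
  rw [hPe, h0, C_0, zero_mul]

end

section
open Set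

/-! ### The induced and non-compact pictures of `w_1 ^ α conj(z_1) ^ β` -/

theorem sqNorm_nonneg {ι : Type} [Fintype ι] (x : ι → ℂ) : 0 ≤ sqNorm x :=
  Finset.sum_nonneg fun _ _ => sq_nonneg _

theorem sqNorm_pos {ι : Type} [Fintype ι] {x : ι → ℂ} (hx : x ≠ 0) : 0 < sqNorm x := by
  obtain ⟨i, hi⟩ := Function.ne_iff.1 hx
  exact Finset.sum_pos' (fun _ _ => sq_nonneg _)
    ⟨i, Finset.mem_univ i, by have := norm_pos_iff.2 hi; positivity⟩

/-- The norm on a product is the supremum norm; this comparison transfers the standard integrability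
of `(1 + ‖x‖²)^(-r/2)`. -/
theorem norm_sq_le_sqNorm {ι : Type} [Fintype ι] (x : ι → ℂ) : ‖x‖ ^ 2 ≤ sqNorm x := by
  have h : ‖x‖ ≤ Real.sqrt (sqNorm x) := by
    refine (pi_norm_le_iff_of_nonneg (Real.sqrt_nonneg _)).2 fun i => ?_
    refine Real.le_sqrt_of_sq_le ?_
    exact Finset.single_le_sum (f := fun i => ‖x i‖ ^ 2) (fun _ _ => sq_nonneg _) (Finset.mem_univ i)
  calc ‖x‖ ^ 2 ≤ Real.sqrt (sqNorm x) ^ 2 := by gcongr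
    _ = sqNorm x := Real.sq_sqrt (sqNorm_nonneg x)

@[fun_prop]
theorem continuous_sqNorm {ι : Type} [Fintype ι] : Continuous fun x : ι → ℂ => sqNorm x := by
  unfold sqNorm; fun_prop

theorem sqNorm_mul_left {ι : Type} [Fintype ι] (c : ℂ) (x : ι → ℂ) :
    sqNorm (fun i => c * x i) = ‖c‖ ^ 2 * sqNorm x := by
  simp only [sqNorm, norm_mul, mul_pow, Finset.mul_sum]

theorem evalAt_P0 (m α β : ℕ) (x : Idx (m + 1) → ℂ) :
    evalAt (P0 m α β) x = x (Sum.inr 0) ^ α * (starRingEnd ℂ) (x (Sum.inl 0)) ^ β := by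
  simp [evalAt, P0]

/-- A unit phase `e` satisfies `conj e = e⁻¹`, so bidegree `(α, β)` yields `e^(α-β)`. -/
theorem inducedForm_P0_mul_left (m α β : ℕ) (lam : ℝ) {c : ℂ} {x : Idx (m + 1) → ℂ} (hc : c ≠ 0) :
    inducedForm lam (P0 m α β) (fun i => c * x i) =
      (c / (‖c‖ : ℂ)) ^ (-((β : ℤ) - (α : ℤ))) *
        (‖c‖ : ℂ) ^ (-(Complex.I * (lam : ℂ)) - 2 * ((m : ℂ) + 1)) *
        inducedForm lam (P0 m α β) x := by
  have hc' : (‖c‖ : ℂ) ≠ 0 := by exact_mod_cast norm_ne_zero_iff.2 hc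
  set e : ℂ := c / (‖c‖ : ℂ) with he
  have he0 : e ≠ 0 := div_ne_zero hc hc'
  have hconj : (starRingEnd ℂ) e = e⁻¹ := by
    rw [Complex.inv_def, Complex.normSq_eq_norm_sq, he, norm_div, Complex.norm_real, norm_norm,
      div_self (norm_ne_zero_iff.2 hc)]
    simp
  have hsq : Real.sqrt (sqNorm fun i => c * x i) = ‖c‖ * Real.sqrt (sqNorm x) := by
    rw [sqNorm_mul_left, Real.sqrt_mul (sq_nonneg _), Real.sqrt_sq (norm_nonneg _)]
  have hx : ∀ i, c * x i / ((‖c‖ * Real.sqrt (sqNorm x) : ℝ) : ℂ) =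
      e * (x i / (Real.sqrt (sqNorm x) : ℂ)) := by
    intro i; rw [he, Complex.ofReal_mul, mul_div_mul_comm]
  have hz : e ^ (-((β : ℤ) - (α : ℤ))) = e ^ α * (e⁻¹) ^ β := by
    rw [neg_sub, zpow_sub₀ he0, zpow_natCast, zpow_natCast, inv_pow, div_eq_mul_inv]
  rw [inducedForm, inducedForm, hsq, evalAt_P0, evalAt_P0]
  simp only [hx]
  rw [Complex.ofReal_mul, Complex.mul_cpow_ofReal_nonneg (norm_nonneg _) (Real.sqrt_nonneg _), hz,
    map_mul, hconj, mul_pow, mul_pow]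
  push_cast
  ring

theorem inducedForm_C_mul {n : ℕ} (lam : ℝ) (c : ℂ) (P : ZPoly n) (x : Idx n → ℂ) :
    inducedForm lam (MvPolynomial.C c * P) x = c * inducedForm lam P x := by
  simp only [inducedForm, evalAt, map_mul, MvPolynomial.eval_C]
  ring

theorem nonStandardForm_C_mul {m : ℕ} (lam : ℝ) (c : ℂ) (P : ZPoly (m + 1)) (s : ℂ)
    (u v : Fin m → ℂ) :
    nonStandardForm lam (MvPolynomial.C c * P) s u v = c * nonStandardForm lam P s u v := by
  simp only [nonStandardForm, fourierTau, fourierXi, nonCompactForm, inducedForm_C_mul, mul_assoc,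
    integral_const_mul]

/-- With `z_1 = 1`, the factor `conj z_1 ^ β` contributes only normalising powers of `√N`, which
join those from `w_1 ^ α` and the homogeneity. -/
theorem nonCompactForm_P0 {m : ℕ} (lam : ℝ) (α β : ℕ) (τ : ℂ) (u ξ : Fin m → ℂ) :
    nonCompactForm lam (P0 m α β) τ u ξ =
      (2 * τ) ^ α / (((1 + 4 * ‖τ‖ ^ 2 + sqNorm u + sqNorm ξ : ℝ) : ℂ) ^
        ((Complex.I * (lam : ℂ) + ((α + β : ℕ) : ℂ)) / 2 + ((m : ℂ) + 1))) := by
  have hN : sqNorm (Sum.elim (Fin.cons 1 u) (Fin.cons (2 * τ) ξ) : Idx (m + 1) → ℂ) =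
      1 + 4 * ‖τ‖ ^ 2 + sqNorm u + sqNorm ξ := by
    simp only [sqNorm, Fintype.sum_sum_type, Fin.sum_univ_succ, Sum.elim_inl, Sum.elim_inr,
      Fin.cons_zero, Fin.cons_succ, norm_one, norm_mul, Complex.norm_two]
    ring
  rw [nonCompactForm, inducedForm, hN, evalAt_P0]
  set N : ℝ := 1 + 4 * ‖τ‖ ^ 2 + sqNorm u + sqNorm ξ
  have hpos : 0 < N := by
    have := sqNorm_nonneg u
    have := sqNorm_nonneg ξ
    positivity
  have hr : 0 < Real.sqrt N := Real.sqrt_pos.2 hpos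
  have hr' : ((Real.sqrt N : ℝ) : ℂ) ≠ 0 := by exact_mod_cast hr.ne'
  simp only [Sum.elim_inl, Sum.elim_inr, Fin.cons_zero]
  rw [map_div₀, map_one, Complex.conj_ofReal]
  have h1 : ∀ z : ℂ, (N : ℂ) ^ z = ((Real.sqrt N : ℝ) : ℂ) ^ (2 * z) := by
    intro z
    conv_lhs => rw [← Real.mul_self_sqrt hpos.le, Complex.ofReal_mul,
      Complex.mul_cpow_ofReal_nonneg hr.le hr.le, ← Complex.cpow_add _ _ hr', ← two_mul]
  rw [h1, show 2 * ((Complex.I * (lam : ℂ) + ((α + β : ℕ) : ℂ)) / 2 + ((m : ℂ) + 1)) =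
      -(-(Complex.I * (lam : ℂ)) - 2 * ((m + 1 : ℕ) : ℂ)) + ((α + β : ℕ) : ℂ) by push_cast; ring,
    Complex.cpow_add _ _ hr', Complex.cpow_natCast, Complex.cpow_neg, pow_add]
  push_cast
  rw [div_pow, div_pow, one_pow]
  field_simp

/-! ### Reduction to a one-dimensional integral -/

theorem integral_cpow_mul_exp_neg_Ioi {μ : ℂ} (hμ : 0 < μ.re) {r : ℝ} (hr : 0 < r) :
    ∫ t in Ioi (0 : ℝ), (t : ℂ) ^ (μ - 1) * (Real.exp (-(r * t)) : ℂ) =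
      Complex.Gamma μ / (r : ℂ) ^ μ := by
  have h := Complex.integral_cpow_mul_exp_neg_mul_Ioi hμ hr
  have hr' : (r : ℂ).arg ≠ Real.pi := by
    rw [Complex.arg_ofReal_of_nonneg hr.le]; exact Real.pi_pos.ne
  rw [one_div, Complex.inv_cpow _ _ hr'] at h
  rw [div_eq_inv_mul, ← h]
  refine setIntegral_congr_fun measurableSet_Ioi fun t _ => ?_
  push_cast
  rfl

/-- The Gaussian integral over `ξ` costs `(π/t)^m`, so `Re μ > m` is what integrability at `t = 0`
demands. -/
theorem integrable_cpow_mul_exp_neg_mul_sqNorm {m : ℕ} {μ : ℂ} (hμ : (m : ℝ) < μ.re) {a : ℝ}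
    (ha : 0 < a) (v : Fin m → ℂ) :
    Integrable (fun p : (Fin m → ℂ) × ℝ => (p.2 : ℂ) ^ (μ - 1) *
      (Real.exp (-((a + sqNorm p.1) * p.2)) : ℂ) * phase (∑ i, v i * p.1 i).re)
      (volume.prod (volume.restrict (Ioi 0))) := by
  have hnorm : ∀ t : ℝ, 0 < t → ∀ ξ : Fin m → ℂ, ‖(t : ℂ) ^ (μ - 1) *
      (Real.exp (-((a + sqNorm ξ) * t)) : ℂ) * phase (∑ i, v i * ξ i).re‖ =
      t ^ (μ.re - 1) * Real.exp (-(a * t)) * Real.exp (-(t * sqNorm ξ)) := by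
    intro t ht ξ
    rw [norm_mul, norm_cpow_mul_exp _ ht, norm_phase, mul_one, mul_assoc, ← Real.exp_add]
    simp only [Complex.sub_re, Complex.one_re]
    ring_nf
  have hmeas : Measurable (fun p : (Fin m → ℂ) × ℝ => (p.2 : ℂ) ^ (μ - 1) *
      (Real.exp (-((a + sqNorm p.1) * p.2)) : ℂ) * phase (∑ i, v i * p.1 i).re) := by
    refine Measurable.mul (Measurable.mul (by fun_prop) ?_) ?_
    · exact Continuous.measurable (by fun_prop)
    · exact Continuous.measurable (by fun_prop)
  refine (integrable_prod_iff' hmeas.aestronglyMeasurable).2 ⟨?_, ?_⟩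
  · refine (ae_restrict_iff' measurableSet_Ioi).2 (Eventually.of_forall fun t ht => ?_)
    have ht : 0 < t := ht
    refine ((integrable_exp_neg_mul_sqNorm ht).const_mul
      (t ^ (μ.re - 1) * Real.exp (-(a * t)))).mono' ?_ (Eventually.of_forall fun ξ => ?_)
    · exact (hmeas.comp measurable_prodMk_right).aestronglyMeasurable
    · exact (hnorm t ht ξ).le
  · have hi : IntegrableOn (fun t : ℝ => Real.pi ^ m * (t ^ (μ.re - 1 - m) * Real.exp (-a * t)))
        (Ioi 0) := by
      refine Integrable.const_mul ?_ _
      have := integrableOn_rpow_mul_exp_neg_mul_rpow (s := μ.re - 1 - m) (p := 1) (b := a)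
        (by linarith) one_pos ha
      simpa [IntegrableOn] using this
    refine Integrable.congr hi ?_
    refine (ae_restrict_iff' measurableSet_Ioi).2 (Eventually.of_forall fun t ht => ?_)
    have ht : 0 < t := ht
    simp only [hnorm t ht]
    rw [integral_const_mul, integral_exp_neg_mul_sqNorm ht, Real.rpow_sub ht (μ.re - 1),
      Real.rpow_natCast, div_pow, neg_mul]
    ring

/-- Fourier transform of a complex power of `a + ‖ξ‖²` on `ℂᵐ`. -/
theorem integral_phase_div_cpow {m : ℕ} {μ : ℂ} (hμ : (m : ℝ) < μ.re) {a : ℝ}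
    (ha : 0 < a) (v : Fin m → ℂ) :
    ∫ ξ : Fin m → ℂ, phase (∑ i, v i * ξ i).re / ((a + sqNorm ξ : ℝ) : ℂ) ^ μ =
      Real.pi ^ m / Complex.Gamma μ * ∫ t in Ioi (0 : ℝ), (t : ℂ) ^ (μ - 1 - m) *
        (Real.exp (-(a * t) - Real.pi ^ 2 * sqNorm v / t) : ℂ) := by
  have hμ0 : 0 < μ.re := (Nat.cast_nonneg m).trans_lt hμ
  have hG := Complex.Gamma_ne_zero_of_re_pos hμ0
  have e : ∀ ξ : Fin m → ℂ, phase (∑ i, v i * ξ i).re / ((a + sqNorm ξ : ℝ) : ℂ) ^ μ =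
      (Complex.Gamma μ)⁻¹ * ∫ t in Ioi (0 : ℝ), (t : ℂ) ^ (μ - 1) *
        (Real.exp (-((a + sqNorm ξ) * t)) : ℂ) * phase (∑ i, v i * ξ i).re := by
    intro ξ
    rw [integral_mul_const, integral_cpow_mul_exp_neg_Ioi hμ0 (by linarith [sqNorm_nonneg ξ])]
    field_simp
  simp only [e]
  rw [integral_const_mul, integral_integral_swap (integrable_cpow_mul_exp_neg_mul_sqNorm hμ ha v),
    div_eq_inv_mul, mul_assoc, ← integral_const_mul (Real.pi ^ m : ℂ)]
  congr 1
  refine setIntegral_congr_fun measurableSet_Ioi fun t ht => ?_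
  have ht : 0 < t := ht
  have ht' : (t : ℂ) ≠ 0 := by exact_mod_cast ht.ne'
  have e2 : ∀ ξ : Fin m → ℂ, (t : ℂ) ^ (μ - 1) *
      (Real.exp (-((a + sqNorm ξ) * t)) : ℂ) * phase (∑ i, v i * ξ i).re =
      (t : ℂ) ^ (μ - 1) * (Real.exp (-(a * t)) : ℂ) *
        ((Real.exp (-(t * sqNorm ξ)) : ℂ) * phase (∑ i, v i * ξ i).re) := by
    intro ξ
    rw [show -((a + sqNorm ξ) * t) = -(a * t) + -(t * sqNorm ξ) by ring, Real.exp_add,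
      Complex.ofReal_mul]
    ring
  simp only [e2]
  rw [integral_const_mul, integral_exp_neg_mul_sqNorm_mul_phase ht, Complex.cpow_sub (μ - 1) _ ht',
    Complex.cpow_natCast, sub_eq_add_neg (-(a * t)), Real.exp_add, Complex.ofReal_mul,
    Complex.ofReal_div, div_pow]
  ring

/-- Integrating over `τ` costs `t^(-α/2-1)`; the factor `exp(-q/t)` compensates any power at `t =
0`, so `κ` is arbitrary. -/
theorem integrable_pow_mul_cpow_mul_exp (α : ℕ) (κ : ℂ) {A q : ℝ} (hA : 0 < A) (hq : 0 < q) (s : ℂ) :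
    Integrable (fun p : ℂ × ℝ => (2 * p.1) ^ α * ((p.2 : ℂ) ^ κ *
      (Real.exp (-((A + 4 * ‖p.1‖ ^ 2) * p.2) - q / p.2) : ℂ)) * phase (s * p.1).re)
      (volume.prod (volume.restrict (Ioi 0))) := by
  have hnorm : ∀ t : ℝ, 0 < t → ∀ τ : ℂ, ‖(2 * τ) ^ α * ((t : ℂ) ^ κ *
      (Real.exp (-((A + 4 * ‖τ‖ ^ 2) * t) - q / t) : ℂ)) * phase (s * τ).re‖ =
      2 ^ α * t ^ κ.re * Real.exp (-(A * t) - q / t) *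
        (‖τ‖ ^ α * Real.exp (-((4 * t) * ‖τ‖ ^ 2))) := by
    intro t ht τ
    rw [norm_mul, norm_mul, norm_cpow_mul_exp _ ht, norm_phase, mul_one, norm_pow, norm_mul,
      Complex.norm_two, mul_pow,
      show -((A + 4 * ‖τ‖ ^ 2) * t) - q / t = (-(A * t) - q / t) + -((4 * t) * ‖τ‖ ^ 2) by ring,
      Real.exp_add]
    ring
  have hmeas : Measurable (fun p : ℂ × ℝ => (2 * p.1) ^ α * ((p.2 : ℂ) ^ κ *
      (Real.exp (-((A + 4 * ‖p.1‖ ^ 2) * p.2) - q / p.2) : ℂ)) * phase (s * p.1).re) := by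
    refine Measurable.mul (Measurable.mul (by fun_prop) (Measurable.mul (by fun_prop) (by fun_prop))) ?_
    exact Continuous.measurable (by fun_prop)
  refine (integrable_prod_iff' hmeas.aestronglyMeasurable).2 ⟨?_, ?_⟩
  · refine (ae_restrict_iff' measurableSet_Ioi).2 (Eventually.of_forall fun t ht => ?_)
    have ht : 0 < t := ht
    refine ((integrable_norm_pow_mul_exp_neg α (b := 4 * t) (by linarith)).const_mul
      (2 ^ α * t ^ κ.re * Real.exp (-(A * t) - q / t))).mono' ?_ (Eventually.of_forall fun τ => ?_)
    · exact (hmeas.comp measurable_prodMk_right).aestronglyMeasurable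
    · exact (hnorm t ht τ).le
  · have hi := (integrableOn_rpow_mul_exp (κ.re - ((α : ℝ) / 2 + 1)) hA hq).const_mul
      (2 ^ α * Real.pi * 4 ^ (-((α : ℝ) / 2 + 1)) * Real.Gamma ((α : ℝ) / 2 + 1))
    refine Integrable.congr hi ?_
    refine (ae_restrict_iff' measurableSet_Ioi).2 (Eventually.of_forall fun t ht => ?_)
    have ht : 0 < t := ht
    simp only [hnorm t ht]
    rw [integral_const_mul, integral_norm_pow_mul_exp_neg α (b := 4 * t) (by linarith),
      Real.mul_rpow (by norm_num) ht.le, sub_eq_add_neg κ.re, Real.rpow_add ht]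
    ring

/-- After Fubini, the Gaussian of width parameter `4t` gives `t^(-α-1)` and `exp(-π²|s|²/(4t))`,
which merges with `exp(-q/t)`. -/
theorem integral_integral_pow_mul_cpow_mul_exp (α : ℕ) (κ : ℂ) {A q : ℝ} (hA : 0 < A) (hq : 0 < q)
    (s : ℂ) :
    ∫ τ : ℂ, ∫ t in Ioi (0 : ℝ), (2 * τ) ^ α * ((t : ℂ) ^ κ *
      (Real.exp (-((A + 4 * ‖τ‖ ^ 2) * t) - q / t) : ℂ)) * phase (s * τ).re =
      2 ^ α * (-Complex.I * Real.pi * (starRingEnd ℂ) s / 4) ^ α * (Real.pi / 4) *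
        ∫ t in Ioi (0 : ℝ), (t : ℂ) ^ (κ - α - 1) *
          (Real.exp (-(A * t) - (q + Real.pi ^ 2 * ‖s‖ ^ 2 / 4) / t) : ℂ) := by
  rw [integral_integral_swap (integrable_pow_mul_cpow_mul_exp α κ hA hq s), ← integral_const_mul]
  refine setIntegral_congr_fun measurableSet_Ioi fun t ht => ?_
  have ht : 0 < t := ht
  have ht' : (t : ℂ) ≠ 0 := by exact_mod_cast ht.ne'
  have e2 : ∀ τ : ℂ, (2 * τ) ^ α * ((t : ℂ) ^ κ *
      (Real.exp (-((A + 4 * ‖τ‖ ^ 2) * t) - q / t) : ℂ)) * phase (s * τ).re =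
      2 ^ α * (t : ℂ) ^ κ * (Real.exp (-(A * t) - q / t) : ℂ) *
        (τ ^ α * ((Real.exp (-((4 * t) * ‖τ‖ ^ 2)) : ℂ) * phase (s * τ).re)) := by
    intro τ
    rw [mul_pow,
      show -((A + 4 * ‖τ‖ ^ 2) * t) - q / t = (-(A * t) - q / t) + -((4 * t) * ‖τ‖ ^ 2) by ring,
      Real.exp_add, Complex.ofReal_mul]
    ring
  simp only [e2]
  rw [integral_const_mul, integral_pow_mul_exp_neg_mul_phase α (b := 4 * t) (by linarith),
    show -(A * t) - (q + Real.pi ^ 2 * ‖s‖ ^ 2 / 4) / t =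
      (-(A * t) - q / t) + -(Real.pi ^ 2 * ‖s‖ ^ 2 / (4 * t)) by field_simp; ring,
    Real.exp_add, Complex.ofReal_mul (Real.exp _), Complex.cpow_sub _ _ ht', Complex.cpow_sub _ _ ht',
    Complex.cpow_natCast, Complex.cpow_one, Complex.ofReal_div, Complex.ofReal_mul,
    Complex.ofReal_ofNat, div_pow, div_pow, mul_pow (4 : ℂ)]
  field_simp

theorem integral_cpow_mul_exp_eq_macdonaldIntegral (ν : ℂ) {p q : ℝ} (hp : 0 < p) :
    ∫ t in Ioi (0 : ℝ), (t : ℂ) ^ (ν - 1) * (Real.exp (-(p * t) - q / t) : ℂ) =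
      (p : ℂ) ^ (-ν) * macdonaldIntegral ν (p * q) := by
  have hp' : (p : ℂ) ≠ 0 := by exact_mod_cast hp.ne'
  have h := integral_comp_mul_left_Ioi
    (fun t : ℝ => (t : ℂ) ^ (ν - 1) * (Real.exp (-t - (p * q) / t) : ℂ)) 0 hp
  rw [mul_zero] at h
  have h2 : ∫ t in Ioi (0 : ℝ), ((p * t : ℝ) : ℂ) ^ (ν - 1) *
      (Real.exp (-(p * t) - (p * q) / (p * t)) : ℂ) = (p : ℂ) ^ (ν - 1) *
      ∫ t in Ioi (0 : ℝ), (t : ℂ) ^ (ν - 1) * (Real.exp (-(p * t) - q / t) : ℂ) := by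
    rw [← integral_const_mul]
    refine setIntegral_congr_fun measurableSet_Ioi fun t ht => ?_
    have ht : 0 < t := ht
    rw [Complex.ofReal_mul, Complex.mul_cpow_ofReal_nonneg hp.le ht.le,
      mul_div_mul_left _ _ hp.ne']
    ring
  rw [h2, ← macdonaldIntegral, Complex.real_smul, Complex.cpow_sub _ _ hp', Complex.cpow_one] at h
  have hpn : (p : ℂ) ^ ν ≠ 0 := by
    rw [Ne, Complex.cpow_eq_zero_iff]
    tauto
  generalize (∫ t in Ioi (0 : ℝ), (t : ℂ) ^ (ν - 1) * (Real.exp (-(p * t) - q / t) : ℂ)) = J at h ⊢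
  rw [Complex.cpow_neg]
  push_cast at h
  field_simp at h ⊢
  linear_combination h

end

section
open Set

/-! ### The non-standard form of `w_1 ^ α conj(z_1) ^ β` -/

/-- The exponent `(iλ + k) / 2 + n` of the denominator, for `n = m + 1`. -/
def exponent (m : ℕ) (lam : ℝ) (k : ℕ) : ℂ :=
  (Complex.I * (lam : ℂ) + (k : ℂ)) / 2 + ((m : ℂ) + 1)

theorem exponent_re (m : ℕ) (lam : ℝ) (k : ℕ) : (exponent m lam k).re = (k : ℝ) / 2 + m + 1 := by
  have : exponent m lam k = (((k : ℝ) / 2 + m + 1 : ℝ) : ℂ) + ((lam / 2 : ℝ) : ℂ) * Complex.I := by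
    rw [exponent]; push_cast; ring
  rw [this]; simp

theorem norm_pow_div_cpow {m : ℕ} (lam : ℝ) (k α : ℕ) (τ : ℂ) {N : ℝ} (hN : 0 < N) :
    ‖(2 * τ) ^ α / (N : ℂ) ^ exponent m lam k‖ = ‖2 * τ‖ ^ α * N ^ (-((k : ℝ) / 2 + m + 1)) := by
  rw [norm_div, norm_pow, Complex.norm_cpow_eq_rpow_re_of_pos hN, exponent_re, Real.rpow_neg hN.le,
    div_eq_mul_inv]

theorem measurable_pow_div_cpow {m : ℕ} (lam : ℝ) (k α : ℕ) (u : Fin m → ℂ) :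
    Measurable fun p : ℂ × (Fin m → ℂ) => (2 * p.1) ^ α /
      (((1 + 4 * ‖p.1‖ ^ 2 + sqNorm u + sqNorm p.2 : ℝ) : ℂ) ^ exponent m lam k) := by
  have h : Measurable fun p : ℂ × (Fin m → ℂ) => 1 + 4 * ‖p.1‖ ^ 2 + sqNorm u + sqNorm p.2 :=
    Continuous.measurable (by fun_prop)
  have h2 : Measurable fun r : ℝ => (r : ℂ) ^ exponent m lam k := by fun_prop
  exact Measurable.div (by fun_prop) (h2.comp h)

theorem integrable_nonCompactForm_P0 {m : ℕ} (lam : ℝ) (α β : ℕ) (τ : ℂ) (u : Fin m → ℂ) :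
    Integrable fun ξ : Fin m → ℂ => nonCompactForm lam (P0 m α β) τ u ξ := by
  simp only [nonCompactForm_P0]
  have hi := (integrable_rpow_neg_one_add_norm_sq (E := Fin m → ℂ) (μ := volume)
    (r := ((α + β : ℕ) : ℝ) + 2 * m + 2) (by
      rw [Module.finrank_pi_fintype]
      simp only [Complex.finrank_real_complex, Finset.sum_const, Finset.card_univ, Fintype.card_fin]
      push_cast
      have : (0 : ℝ) ≤ α := Nat.cast_nonneg α
      have : (0 : ℝ) ≤ β := Nat.cast_nonneg β
      simp; linarith)).const_mul (‖2 * τ‖ ^ α)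
  refine hi.mono' ((measurable_pow_div_cpow lam (α + β) α u).comp
    measurable_prodMk_left).aestronglyMeasurable (Eventually.of_forall fun ξ => ?_)
  have h1 := sqNorm_nonneg u
  have h2 := norm_sq_le_sqNorm ξ
  have h3 : 0 ≤ ‖ξ‖ ^ 2 := sq_nonneg _
  have h4 : 0 ≤ 4 * ‖τ‖ ^ 2 := by positivity
  rw [← exponent, norm_pow_div_cpow lam (α + β) α τ (by linarith),
    show -(((α + β : ℕ) : ℝ) + 2 * m + 2) / 2 = -(((α + β : ℕ) : ℝ) / 2 + m + 1) by ring]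
  refine mul_le_mul_of_nonneg_left ?_ (by positivity)
  refine Real.rpow_le_rpow_of_nonpos (by linarith) (by linarith) ?_
  have : (0 : ℝ) ≤ ((α + β : ℕ) : ℝ) / 2 + m + 1 := by positivity
  linarith

theorem integrand_eq {m : ℕ} (lam : ℝ) (α β : ℕ) (s : ℂ) (u v : Fin m → ℂ) (τ : ℂ) (ξ : Fin m → ℂ) :
    integrand lam (α + β) α s u v τ ξ = nonCompactForm lam (P0 m α β) τ u ξ *
      phase (∑ i, v i * ξ i).re * phase (s * τ).re := by
  rw [integrand, nonCompactForm_P0, Complex.add_re, ← phase, phase_add]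
  ring

/-- Since `|2τ|^α ≤ N^(α/2)`, the integrand is at most `N^(-(β+2m+2)/2)`; the real dimension is `2m
+ 2`, whence `β ≥ 1`. -/
theorem integrable_integrand {m : ℕ} (lam : ℝ) {α β : ℕ} (hβ : 1 ≤ β) (s : ℂ) (u v : Fin m → ℂ) :
    Integrable fun p : ℂ × (Fin m → ℂ) => integrand lam (α + β) α s u v p.1 p.2 := by
  have hfin : (Module.finrank ℝ (ℂ × (Fin m → ℂ)) : ℝ) < (β : ℝ) + 2 * m + 2 := by
    rw [Module.finrank_prod, Module.finrank_pi_fintype]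
    simp only [Complex.finrank_real_complex, Finset.sum_const, Finset.card_univ, Fintype.card_fin]
    have : (1 : ℝ) ≤ β := by exact_mod_cast hβ
    push_cast
    simp; linarith
  have hmeas : Measurable fun p : ℂ × (Fin m → ℂ) => integrand lam (α + β) α s u v p.1 p.2 := by
    simp only [integrand_eq, nonCompactForm_P0]
    refine Measurable.mul (Measurable.mul (measurable_pow_div_cpow lam (α + β) α u) ?_) ?_
    · exact Continuous.measurable (by fun_prop)
    · exact Continuous.measurable (by fun_prop)
  have : (volume : Measure (ℂ × (Fin m → ℂ))).IsAddHaarMeasure :=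
    Measure.prod.instIsAddHaarMeasure _ _
  refine (integrable_rpow_neg_one_add_norm_sq (μ := volume) hfin).mono' hmeas.aestronglyMeasurable
    (Eventually.of_forall fun p => ?_)
  obtain ⟨τ, ξ⟩ := p
  have h1 := sqNorm_nonneg u
  have h2 := norm_sq_le_sqNorm ξ
  have h2' := sqNorm_nonneg ξ
  have h3 : 0 ≤ ‖τ‖ ^ 2 := sq_nonneg _
  set N : ℝ := 1 + 4 * ‖τ‖ ^ 2 + sqNorm u + sqNorm ξ with hN
  have hNpos : 0 < N := by rw [hN]; linarith
  have hle : 1 + ‖((τ, ξ) : ℂ × (Fin m → ℂ))‖ ^ 2 ≤ N := by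
    rcases max_cases ‖τ‖ ‖ξ‖ with ⟨h, -⟩ | ⟨h, -⟩ <;> rw [Prod.norm_mk, h] <;> linarith
  have h2τ : ‖2 * τ‖ ^ α ≤ N ^ ((α : ℝ) / 2) := by
    have : ‖2 * τ‖ ≤ N ^ ((1 : ℝ) / 2) := by
      rw [← Real.sqrt_eq_rpow]
      refine Real.le_sqrt_of_sq_le ?_
      rw [norm_mul, Complex.norm_two]
      nlinarith
    calc ‖2 * τ‖ ^ α ≤ (N ^ ((1 : ℝ) / 2)) ^ α := by gcongr
      _ = N ^ ((α : ℝ) / 2) := by rw [← Real.rpow_natCast, ← Real.rpow_mul hNpos.le]; ring_nf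
  rw [integrand_eq, nonCompactForm_P0, norm_mul, norm_mul, norm_phase, norm_phase, mul_one, mul_one,
    ← exponent, norm_pow_div_cpow lam (α + β) α τ hNpos]
  calc ‖2 * τ‖ ^ α * N ^ (-(((α + β : ℕ) : ℝ) / 2 + m + 1))
      ≤ N ^ ((α : ℝ) / 2) * N ^ (-(((α + β : ℕ) : ℝ) / 2 + m + 1)) := by gcongr
    _ = N ^ (-((β : ℝ) + 2 * m + 2) / 2) := by
        rw [← Real.rpow_add hNpos]; push_cast; ring_nf
    _ ≤ _ := by
        refine Real.rpow_le_rpow_of_nonpos (by positivity) hle ?_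
        have : (0 : ℝ) ≤ (β : ℝ) + 2 * m + 2 := by positivity
        linarith

theorem nonStandardForm_P0_eq_integral_integrand {m : ℕ} (lam : ℝ) (α β : ℕ) (s : ℂ)
    (u v : Fin m → ℂ) :
    nonStandardForm lam (P0 m α β) s u v =
      ∫ τ : ℂ, ∫ ξ : Fin m → ℂ, integrand lam (α + β) α s u v τ ξ := by
  simp only [integrand_eq, integral_mul_const]
  rfl

theorem fourierXi_nonCompactForm_P0 {m : ℕ} (lam : ℝ) (α β : ℕ) (τ : ℂ) (u v : Fin m → ℂ) :
    fourierXi (nonCompactForm lam (P0 m α β)) τ u v =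
      Real.pi ^ m / Complex.Gamma (exponent m lam (α + β)) *
        ∫ t in Ioi (0 : ℝ), (2 * τ) ^ α * ((t : ℂ) ^ (exponent m lam (α + β) - 1 - m) *
          (Real.exp (-((1 + sqNorm u + 4 * ‖τ‖ ^ 2) * t) - Real.pi ^ 2 * sqNorm v / t) : ℂ)) := by
  have hu := sqNorm_nonneg u
  have hμ : (m : ℝ) < (exponent m lam (α + β)).re := by
    rw [exponent_re]
    have : (0 : ℝ) ≤ ((α + β : ℕ) : ℝ) / 2 := by positivity
    linarith
  rw [integral_const_mul, mul_left_comm, ← integral_phase_div_cpow hμ (by positivity) v,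
    ← integral_const_mul, fourierXi]
  refine integral_congr_ae (Eventually.of_forall fun ξ => ?_)
  simp only [nonCompactForm_P0]
  rw [← phase, ← exponent,
    show 1 + sqNorm u + 4 * ‖τ‖ ^ 2 + sqNorm ξ = 1 + 4 * ‖τ‖ ^ 2 + sqNorm u + sqNorm ξ by ring]
  ring

theorem integrable_fourierXi_nonCompactForm_P0 {m : ℕ} (lam : ℝ) (α β : ℕ) (u : Fin m → ℂ)
    {v : Fin m → ℂ} (hv : v ≠ 0) :
    Integrable fun τ : ℂ => fourierXi (nonCompactForm lam (P0 m α β)) τ u v := by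
  have hu := sqNorm_nonneg u
  have hv' := sqNorm_pos hv
  simp only [fourierXi_nonCompactForm_P0]
  refine Integrable.const_mul ?_ _
  -- The choice `s = 0` makes the phase equal to `1`, leaving the partial transform itself.
  have h := (integrable_pow_mul_cpow_mul_exp α (exponent m lam (α + β) - 1 - m)
    (A := 1 + sqNorm u) (q := Real.pi ^ 2 * sqNorm v) (by positivity) (by positivity) 0).integral_prod_left
  simpa [phase] using h

theorem nonStandardForm_P0_eq_macdonaldIntegral {m : ℕ} (lam : ℝ) (α β : ℕ) (s : ℂ)
    (u : Fin m → ℂ) {v : Fin m → ℂ} (hv : v ≠ 0) :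
    nonStandardForm lam (P0 m α β) s u v =
      Real.pi ^ m / Complex.Gamma (exponent m lam (α + β)) *
        (2 ^ α * (-Complex.I * Real.pi * (starRingEnd ℂ) s / 4) ^ α * (Real.pi / 4) *
          (((1 + sqNorm u : ℝ) : ℂ) ^ (-((Complex.I * (lam : ℂ) + (((β : ℤ) - (α : ℤ) : ℤ) : ℂ)) / 2)) *
            macdonaldIntegral ((Complex.I * (lam : ℂ) + (((β : ℤ) - (α : ℤ) : ℤ) : ℂ)) / 2)
              ((1 + sqNorm u) * (Real.pi ^ 2 * sqNorm v + Real.pi ^ 2 * ‖s‖ ^ 2 / 4)))) := by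
  have hu := sqNorm_nonneg u
  have hv' := sqNorm_pos hv
  have h := integral_integral_pow_mul_cpow_mul_exp α (exponent m lam (α + β) - 1 - m)
    (A := 1 + sqNorm u) (q := Real.pi ^ 2 * sqNorm v) (by positivity) (by positivity) s
  -- The shift by `α` turns `k/2 = (α+β)/2` into `δ/2`, the order of the Bessel function.
  have hν : exponent m lam (α + β) - 1 - m - α - 1 =
      (Complex.I * (lam : ℂ) + (((β : ℤ) - (α : ℤ) : ℤ) : ℂ)) / 2 - 1 := by
    rw [exponent]; push_cast; ring
  rw [hν, integral_cpow_mul_exp_eq_macdonaldIntegral _ (by positivity)] at h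
  rw [← h, nonStandardForm, fourierTau, ← integral_const_mul]
  refine integral_congr_ae (Eventually.of_forall fun τ => ?_)
  simp only [fourierXi_nonCompactForm_P0]
  rw [← phase, integral_mul_const, mul_assoc]

theorem psi_eq_macdonaldIntegral {m : ℕ} (lam : ℝ) (α β : ℕ) (s : ℂ)
    (u : Fin m → ℂ) {v : Fin m → ℂ} (hv : v ≠ 0) :
    psi lam (α + β) α β ((β : ℤ) - (α : ℤ)) s u v =
      Real.pi ^ m / Complex.Gamma (exponent m lam (α + β)) *
        (2 ^ α * (-Complex.I * Real.pi * (starRingEnd ℂ) s / 4) ^ α * (Real.pi / 4) *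
          (((1 + sqNorm u : ℝ) : ℂ) ^ (-((Complex.I * (lam : ℂ) + (((β : ℤ) - (α : ℤ) : ℤ) : ℂ)) / 2)) *
            macdonaldIntegral ((Complex.I * (lam : ℂ) + (((β : ℤ) - (α : ℤ) : ℤ) : ℂ)) / 2)
              ((1 + sqNorm u) * (Real.pi ^ 2 * sqNorm v + Real.pi ^ 2 * ‖s‖ ^ 2 / 4)))) := by
  have hu := sqNorm_nonneg u
  have hv' := sqNorm_pos hv
  have hpi := Real.pi_pos
  set A : ℝ := 1 + sqNorm u with hA
  have hApos : 0 < A := by positivity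
  set B : ℝ := ‖s‖ ^ 2 + 4 * sqNorm v with hB
  have hBpos : 0 < B := by positivity
  set ν : ℂ := (Complex.I * (lam : ℂ) + (((β : ℤ) - (α : ℤ) : ℤ) : ℂ)) / 2 with hν
  have ha : 0 < Real.sqrt A := Real.sqrt_pos.2 hApos
  have hb : 0 < Real.sqrt B := Real.sqrt_pos.2 hBpos
  have hx : 0 < Real.pi * Real.sqrt A * Real.sqrt B := by positivity
  -- The half-argument squared in `besselK_eq` is exactly the parameter left by the two Fourier
  -- transforms.
  have hq : (Real.pi * Real.sqrt A * Real.sqrt B / 2) ^ 2 =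
      A * (Real.pi ^ 2 * sqNorm v + Real.pi ^ 2 * ‖s‖ ^ 2 / 4) := by
    rw [div_pow, mul_pow, mul_pow, Real.sq_sqrt hApos.le, Real.sq_sqrt hBpos.le, hB]
    ring
  have hpiC : (Real.pi : ℂ) ≠ 0 := by exact_mod_cast hpi.ne'
  have haC : ((Real.sqrt A : ℝ) : ℂ) ≠ 0 := by exact_mod_cast ha.ne'
  have hbC : ((Real.sqrt B : ℝ) : ℂ) ≠ 0 := by exact_mod_cast hb.ne'
  have hne : ∀ (z w : ℂ), z ≠ 0 → z ^ w ≠ 0 := by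
    intro z w hz
    rw [Ne, Complex.cpow_eq_zero_iff]
    tauto
  have hmul : ∀ (x y : ℝ) (w : ℂ), 0 < x → 0 < y → ((x * y : ℝ) : ℂ) ^ w = (x : ℂ) ^ w * (y : ℂ) ^ w := by
    intro x y w hx hy
    rw [Complex.ofReal_mul, Complex.mul_cpow_ofReal_nonneg hx.le hy.le]
  have hdiv : ∀ (x y : ℝ) (w : ℂ), 0 < x → 0 < y → ((x / y : ℝ) : ℂ) ^ w = (x : ℂ) ^ w / (y : ℂ) ^ w := by
    intro x y w hx hy
    rw [eq_div_iff (hne _ _ (by exact_mod_cast hy.ne')), ← hmul _ _ _ (by positivity) hy,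
      div_mul_cancel₀ _ hy.ne']
  have hAν : (A : ℂ) ^ ν = ((Real.sqrt A : ℝ) : ℂ) ^ ν * ((Real.sqrt A : ℝ) : ℂ) ^ ν := by
    rw [← hmul _ _ _ ha ha, Real.mul_self_sqrt hApos.le]
  have hpipow : (Real.pi : ℂ) ^ (Complex.I * (lam : ℂ) + (β : ℂ) + ((m : ℂ) + 1)) =
      (Real.pi : ℂ) ^ ν * (Real.pi : ℂ) ^ ν * (Real.pi : ℂ) ^ α * ((Real.pi : ℂ) ^ m * Real.pi) := by
    rw [← Complex.cpow_add _ _ hpiC, ← Complex.cpow_natCast, ← Complex.cpow_add _ _ hpiC,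
      ← pow_succ, ← Complex.cpow_natCast, ← Complex.cpow_add _ _ hpiC]
    congr 1
    rw [hν]; push_cast; ring
  have h2pow : (2 : ℂ) ^ ((Complex.I * (lam : ℂ) + ((α + β : ℕ) : ℂ)) / 2 + 1) =
      (2 : ℂ) ^ ν * 2 ^ α * 2 := by
    have e : (Complex.I * (lam : ℂ) + ((α + β : ℕ) : ℂ)) / 2 + 1 = ν + α + 1 := by
      rw [hν]; push_cast; ring
    rw [e, Complex.cpow_add _ _ two_ne_zero, Complex.cpow_add _ _ two_ne_zero, Complex.cpow_natCast,
      Complex.cpow_one]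
  have hG : Complex.Gamma (exponent m lam (α + β)) ≠ 0 := by
    refine Complex.Gamma_ne_zero_of_re_pos ?_
    rw [exponent_re]; positivity
  rw [psi, prefactor, ← hν, besselK_eq _ hx, ← exponent, hpipow, h2pow, hq, Complex.cpow_neg, Complex.cpow_neg,
    hdiv _ _ _ hx two_pos, hmul _ _ _ (by positivity) hb, hmul _ _ _ hpi ha,
    hdiv _ _ _ hb (by positivity), hmul _ _ _ hpi ha, hAν]
  have e1 := hne _ ν hpiC
  have e2 := hne _ ν haC
  have e3 := hne _ ν hbC
  have e4 := hne _ ν (two_ne_zero' ℂ)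
  have h4 : (4 : ℂ) ^ α = 2 ^ α * 2 ^ α := by rw [← mul_pow]; norm_num
  rw [div_pow, h4, Complex.ofReal_ofNat, mul_right_comm (-Complex.I), mul_pow (-Complex.I * _)]
  -- Once the complex powers are opaque nonzero symbols, the comparison is an identity of rational
  -- expressions.
  generalize (Real.pi : ℂ) ^ ν = p1 at *
  generalize ((Real.sqrt A : ℝ) : ℂ) ^ ν = p2 at *
  generalize ((Real.sqrt B : ℝ) : ℂ) ^ ν = p3 at *
  generalize (2 : ℂ) ^ ν = p4 at *
  generalize (-Complex.I * (starRingEnd ℂ) s) ^ α = p5 at *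
  field_simp
  ring

end

end NonStd

end

theorem theorem4 (m : ℕ) (hm : 1 ≤ m) (lam : ℝ) (k α β : ℕ) (hk : k = α + β)
    (δ : ℤ) (hδ : δ = (β : ℤ) - (α : ℤ)) :
    -- `P0` is a highest weight vector of weight `(k, 0, …, 0)`
    (IsHarm α β (P0 m α β) ∧ IsHighestWeightVector (Pi.single 0 (k : ℤ)) (P0 m α β)) ∧
    -- the extension of its restriction to the sphere belongs to the induced picture
    (∀ (c : ℂ) (x : Idx (m + 1) → ℂ), c ≠ 0 → x ≠ 0 →
      inducedForm lam (P0 m α β) (fun i => c * x i) =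
        (c / (‖c‖ : ℂ)) ^ (-δ) *
          (‖c‖ : ℂ) ^ (-(Complex.I * (lam : ℂ)) - 2 * ((m : ℂ) + 1)) *
          inducedForm lam (P0 m α β) x) ∧
    -- its non-standard form: the integrals converge and have the stated value
    (∀ (s : ℂ) (u v : Fin m → ℂ), s ≠ 0 → v ≠ 0 →
      (∀ τ : ℂ, MeasureTheory.Integrable
        (fun ξ : Fin m → ℂ => nonCompactForm lam (P0 m α β) τ u ξ)) ∧
      MeasureTheory.Integrable
        (fun τ : ℂ => fourierXi (nonCompactForm lam (P0 m α β)) τ u v) ∧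
      nonStandardForm lam (P0 m α β) s u v =
        ∫ τ : ℂ, ∫ ξ : Fin m → ℂ, integrand lam k α s u v τ ξ ∧
      nonStandardForm lam (P0 m α β) s u v = psi lam k α β δ s u v ∧
      (1 ≤ β →
        MeasureTheory.Integrable
          (fun p : ℂ × (Fin m → ℂ) => integrand lam k α s u v p.1 p.2) ∧
        nonStandardForm lam (P0 m α β) s u v =
          ∫ p : ℂ × (Fin m → ℂ), integrand lam k α s u v p.1 p.2)) ∧
    -- every highest weight vector of this weight has a non-standard form proportional to `psi`
    (∀ P : ZPoly (m + 1), IsHarm α β P →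
      IsHighestWeightVector (Pi.single 0 (k : ℤ)) P →
      ∃ c : ℂ, c ≠ 0 ∧ ∀ (s : ℂ) (u v : Fin m → ℂ), s ≠ 0 → v ≠ 0 →
        nonStandardForm lam P s u v = c * psi lam k α β δ s u v) := by
  subst hk hδ
  have hmain : ∀ (s : ℂ) (u v : Fin m → ℂ), v ≠ 0 →
      nonStandardForm lam (P0 m α β) s u v = psi lam (α + β) α β ((β : ℤ) - (α : ℤ)) s u v :=
    fun s u v hv => by
      rw [nonStandardForm_P0_eq_macdonaldIntegral lam α β s u hv, psi_eq_macdonaldIntegral lam α β s u hv]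
  refine ⟨⟨isHarm_P0 m α β, isHighestWeightVector_P0 m α β⟩,
    fun c x hc _ => inducedForm_P0_mul_left m α β lam hc, fun s u v _ hv =>
    ⟨fun τ => integrable_nonCompactForm_P0 lam α β τ u,
      integrable_fourierXi_nonCompactForm_P0 lam α β u hv,
      nonStandardForm_P0_eq_integral_integrand lam α β s u v, hmain s u v hv, fun hβ => ?_⟩,
    fun P hP hw => ?_⟩
  · have hi := integrable_integrand lam (α := α) hβ s u v
    exact ⟨hi, (nonStandardForm_P0_eq_integral_integrand lam α β s u v).trans
      (integral_prod _ hi).symm⟩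
  · obtain ⟨c, hc, rfl⟩ := eq_C_mul_P0 hP hw
    exact ⟨c, hc, fun s u v _ hv => by rw [nonStandardForm_C_mul, hmain s u v hv]⟩
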